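/- Let $d>0$, $\overline u_1>0$, $T>d/\overline u_1$, $L=3\overline u_1T$, and let $\mathbb T_L$ be the torus $(-L,d+L)$ with periodic conditions (length $d+2L$). Set $Q=(\mathbb T_L\times(0,1))\times(0,T)$, $\omega=((-L,0)\times(0,1))\cup((d,d+L]\times(0,1))$ and $\omega_T=\omega\times(0,T)$; points of $Q$ are written $(x,z,t)$ and $\nabla=(\partial_x,\partial_z)$. Weights. Let $\eta\in C^6(\mathbb T_L)$ with $\eta>0$ and $\inf|\eta'|>0$ outside $(-3\overline u_1T,-2\overline u_1T)\cup(d+\overline u_1T,d+3\overline u_1T)$, and put $\eta^0(x,t)=\eta(x-\overline u_1t)$. Let $T_0,T_1>0$ with $2T_0+2T_1<T-d/\overline u_1$, and let $\theta\in C^4(0,T)$ satisfy $\theta(t)=t^{-2}$ on $(0,T_0]$, $\theta$ strictly decreasing on $[T_0,2T_0]$, $\theta=1$ on $[2T_0,T-2T_1]$, $\theta$ strictly increasing on $[T-2T_1,T-T_1]$, and $\theta(t)=(T-t)^{-2}$ on $[T-T_1,T)$. For $\lambda\ge1$ define $$\phi=\theta(t)\bigl(e^{6\lambda\|\eta^0\|_\infty}-e^{\lambda(\eta^0(x,t)+4\|\eta^0\|_\infty)}\bigr),\qquad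 \xi=\theta(t)\,e^{\lambda(\eta^0(x,t)+4\|\eta^0\|_\infty)},$$ where $\|\eta^0\|_\infty$ is the supremum of $|\eta^0|$ on $\mathbb T_L\times[0,T]$. Let $c\in\mathbb R$ and consider weak solutions $\sigma\in L^2(Q)$ of $$-\partial_t\sigma-\overline u_1\partial_x\sigma+c\,\sigma=f_4\ \text{ in } Q,\qquad \sigma(\cdot,T)=\sigma_T\ \text{ in }\mathbb T_L\times(0,1).\tag{$*$}$$ Theorem. In each of the following three statements, $C$ depends only on $d,\overline u_1,T,\eta,T_0,T_1,\theta,c$ (not on $s,\lambda,\sigma_T,f_4,\sigma$). (i) There is $C>0$ such that for all $\sigma_T\in L^2(\mathbb T_L\times(0,1))$, $f_4\in L^2(Q)$ and all $s\ge1$, $\lambda\ge1$, the solution $\sigma$ of $(*)$ satisfies $$\|\xi^{-1/2}\sigma e^{-s\phi}\|^2_{L^2(Q)}\le C\bigl(\|\xi^{-1/2}f_4e^{-s\phi}\|^2_{L^2(Q)}+\|\xi^{-1/2}\sigma e^{-s\phi}\|^2_{L^2(\omega_T)}\bigr).$$ (ii) There is $C>0$ such that for all $\sigma_T\in H^1(\mathbb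 T_L\times(0,1))$ and $f_4\in L^2(0,T;H^1(\mathbb T_L\times(0,1)))$, the solution $\sigma$ of $(*)$ has a weak gradient $\nabla\sigma\in L^2(Q)^2$ and, for all $s\ge1$, $\lambda\ge1$, $$\|\xi^{-1/2}\nabla\sigma e^{-s\phi}\|^2_{L^2(Q)}\le C\bigl(\|\xi^{-1/2}\nabla f_4e^{-s\phi}\|^2_{L^2(Q)}+\|\xi^{-1/2}\nabla\sigma e^{-s\phi}\|^2_{L^2(\omega_T)}\bigr).$$ (iii) There is $C>0$ such that for $\sigma_T$, $f_4$ as in (ii), the solution $\sigma$ of $(*)$ has weak derivatives $\nabla\sigma\in L^2(Q)^2$, $\partial_t\sigma\in L^2(Q)$ and, for all $s\ge1$, $\lambda\ge1$, $$\|\xi^{-1/2}\partial_t\sigma e^{-s\phi}\|^2_{L^2(Q)}\le C\bigl(\|\xi^{-1/2}\nabla f_4e^{-s\phi}\|^2_{L^2(Q)}+\|\xi^{-1/2}f_4e^{-s\phi}\|^2_{L^2(Q)}+\|\xi^{-1/2}\sigma e^{-s\phi}\|^2_{L^2(\omega_T)}+\|\xi^{-1/2}\nabla\sigma e^{-s\phi}\|^2_{L^2(\omega_T)}\bigr).$$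 -/

import Mathlib

open MeasureTheory Set
open scoped NNReal ENNReal ContDiff

noncomputable section

namespace TransportObs

/-- The physical data: channel length `d`, velocity `u` (the first component of the constant
velocity field) and time horizon `T`, larger than the crossing time `d / u`. -/
structure Channel where
  d : ℝ
  u : ℝ
  T : ℝ
  d_pos : 0 < d
  u_pos : 0 < u
  crossing_lt : d / u < T

namespace Channel

variable (G : Channel)

/-- The extension length `L = 3 u T`. -/
def L : ℝ := 3 * G.u * G.T

/-- The torus `𝕋_L` is the interval `(-L, d + L)` with periodic conditions; this is its length. -/
def period : ℝ := G.d + 2 * G.L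

theorem T_pos : 0 < G.T := lt_trans (div_pos G.d_pos G.u_pos) G.crossing_lt

instance period_pos : Fact (0 < G.period) :=
  ⟨by
    have h := mul_pos G.u_pos G.T_pos
    have hd := G.d_pos
    unfold period L
    nlinarith⟩

/-- The one dimensional torus `𝕋_L`, with its Lebesgue (Haar) measure of total mass `d + 2 L`. -/
abbrev Torus : Type := AddCircle G.period

/-- The extended channel `𝕋_L × (0,1)`. -/
def Omega : Set (G.Torus × ℝ) := {p | p.2 ∈ Ioo (0 : ℝ) 1}

/-- The space-time cylinder `(𝕋_L × (0,1)) × (0,T)`; points are written `(x, z, t)`. -/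
def Q : Set (G.Torus × ℝ × ℝ) := {q | q.2.1 ∈ Ioo (0 : ℝ) 1 ∧ q.2.2 ∈ Ioo (0 : ℝ) G.T}

/-- The observation cylinder `ω × (0,T)`, where
`ω = ((-L,0) × (0,1)) ∪ ((d,d+L] × (0,1))`. -/
def omegaT : Set (G.Torus × ℝ × ℝ) :=
  {q | q.1 ∈ (fun x : ℝ => (x : G.Torus)) '' (Ioo (-G.L) 0 ∪ Ioc G.d (G.d + G.L)) ∧
    q.2.1 ∈ Ioo (0 : ℝ) 1 ∧ q.2.2 ∈ Ioo (0 : ℝ) G.T}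

end Channel

/-! Test functions and weak derivatives on open subsets of `𝕋_L × E`, where `E` is `ℝ`
(variable `z`) or `ℝ × ℝ` (variables `z, t`). -/

section Weak

variable (G : Channel) {E : Type*} [NormedAddCommGroup E] [NormedSpace ℝ E]

/-- `χ ∈ C_c^∞(U)`; smoothness is smoothness of the lift, periodic in the first variable. -/
structure IsTest (U : Set (G.Torus × E)) (χ : G.Torus × E → ℝ) : Prop where
  smooth : ContDiff ℝ ∞ (fun p : ℝ × E => χ ((p.1 : G.Torus), p.2))
  compact : HasCompactSupport χ
  support_subset : tsupport χ ⊆ U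

/-- The derivative of `χ` in the direction `v`. -/
def dirDeriv (v : ℝ × E) (χ : G.Torus × E → ℝ) (q : G.Torus × E) : ℝ :=
  deriv (fun h : ℝ => χ (q.1 + ((h * v.1 : ℝ) : G.Torus), q.2 + h • v.2)) 0

/-- `g` is the weak derivative of `f` in the direction `v` in the open set `U`. -/
def HasWeakDeriv [MeasureSpace E] (U : Set (G.Torus × E)) (v : ℝ × E)
    (f g : G.Torus × E → ℝ) : Prop :=
  ∀ χ : G.Torus × E → ℝ, IsTest G U χ →
    ∫ q in U, f q * dirDeriv G v χ q = - ∫ q in U, g q * χ q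

end Weak

section Solutions

variable (G : Channel)

/-- `σT ∈ H¹(𝕋_L × (0,1))`. -/
def MemH1 (σT : G.Torus × ℝ → ℝ) : Prop :=
  MemLp σT 2 (volume.restrict G.Omega) ∧
    ∃ gx gz : G.Torus × ℝ → ℝ,
      MemLp gx 2 (volume.restrict G.Omega) ∧ MemLp gz 2 (volume.restrict G.Omega) ∧
      HasWeakDeriv G G.Omega (1, 0) σT gx ∧ HasWeakDeriv G G.Omega (0, 1) σT gz

/-- `f ∈ L²(0,T; H¹(𝕋_L × (0,1)))` with weak spatial gradient `g = (∂ₓ f, ∂_z f)`. -/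
structure HasL2Gradient (f : G.Torus × ℝ × ℝ → ℝ)
    (g : G.Torus × ℝ × ℝ → EuclideanSpace ℝ (Fin 2)) : Prop where
  memLp : MemLp f 2 (volume.restrict G.Q)
  memLp_grad : MemLp g 2 (volume.restrict G.Q)
  deriv_x : HasWeakDeriv G G.Q (1, (0, 0)) f (fun q => g q 0)
  deriv_z : HasWeakDeriv G G.Q (0, (1, 0)) f (fun q => g q 1)

/-- `h ∈ L²(Q)` is the weak time derivative of `f`. -/
structure HasL2TimeDeriv (f h : G.Torus × ℝ × ℝ → ℝ) : Prop where
  memLp : MemLp h 2 (volume.restrict G.Q)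
  deriv_t : HasWeakDeriv G G.Q (0, (0, 1)) f h

/-- `σ ∈ L²(Q)` is the (weak) solution of `-∂ₜσ - u ∂ₓσ + c σ = f` in `Q`, `σ(·,T) = σT`.
The test functions vanish near `t = 0` (and near `z = 0`, `z = 1`) but not at `t = T`. -/
structure IsSolution (c : ℝ) (f : G.Torus × ℝ × ℝ → ℝ) (σT : G.Torus × ℝ → ℝ)
    (σ : G.Torus × ℝ × ℝ → ℝ) : Prop where
  memLp : MemLp σ 2 (volume.restrict G.Q)
  weak : ∀ χ : G.Torus × ℝ × ℝ → ℝ,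
    IsTest G {q | q.2.1 ∈ Ioo (0 : ℝ) 1 ∧ 0 < q.2.2} χ →
    ∫ q in G.Q, σ q *
        (dirDeriv G (0, (0, 1)) χ q + G.u * dirDeriv G (1, (0, 0)) χ q + c * χ q) =
      (∫ q in G.Q, f q * χ q) + ∫ p in G.Omega, σT p * χ (p.1, p.2, G.T)

end Solutions

/-- The data of the weight functions: the spatial profile `η` on the torus, the
times `T₀`, `T₁` and the time weight `θ`. -/
structure WeightData (G : Channel) where
  η : G.Torus → ℝ
  T0 : ℝ
  T1 : ℝ
  θ : ℝ → ℝ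
  η_smooth : ContDiff ℝ 6 (fun x : ℝ => η (x : G.Torus))
  η_pos : ∀ x, 0 < η x
  η_grad : ∃ m : ℝ, 0 < m ∧ ∀ x ∈ Ioo (-G.L) (G.d + G.L) \
      (Ioo (-3 * G.u * G.T) (-2 * G.u * G.T) ∪
        Ioo (G.d + G.u * G.T) (G.d + 3 * G.u * G.T)),
      m ≤ |deriv (fun y : ℝ => η (y : G.Torus)) x|
  T0_pos : 0 < T0
  T1_pos : 0 < T1
  T0_T1_small : 2 * T0 + 2 * T1 < G.T - G.d / G.u
  θ_smooth : ContDiffOn ℝ 4 θ (Ioo 0 G.T)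
  θ_left : ∀ t ∈ Ioc 0 T0, θ t = 1 / t ^ 2
  θ_anti : StrictAntiOn θ (Icc T0 (2 * T0))
  θ_mid : ∀ t ∈ Icc (2 * T0) (G.T - 2 * T1), θ t = 1
  θ_mono : StrictMonoOn θ (Icc (G.T - 2 * T1) (G.T - T1))
  θ_right : ∀ t ∈ Ico (G.T - T1) G.T, θ t = 1 / (G.T - t) ^ 2

namespace WeightData

variable {G : Channel} (W : WeightData G)

/-- `η⁰(x,t) = η(x - u t)`. -/
def η0 (x : G.Torus) (t : ℝ) : ℝ := W.η (x - ((G.u * t : ℝ) : G.Torus))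

/-- `‖η⁰‖_∞`, the maximum of `|η⁰|` on `𝕋_L × [0,T]`. -/
def supη0 : ℝ := ⨆ p : G.Torus × Icc (0 : ℝ) G.T, |W.η0 p.1 p.2|

/-- `φ = θ(t) (e^{6 λ ‖η⁰‖} - e^{λ (η⁰ + 4 ‖η⁰‖)})`. -/
def phi (lam : ℝ) (x : G.Torus) (t : ℝ) : ℝ :=
  W.θ t * (Real.exp (6 * lam * W.supη0) - Real.exp (lam * (W.η0 x t + 4 * W.supη0)))

/-- `ξ = θ(t) e^{λ (η⁰ + 4 ‖η⁰‖)}`. -/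
def xi (lam : ℝ) (x : G.Torus) (t : ℝ) : ℝ :=
  W.θ t * Real.exp (lam * (W.η0 x t + 4 * W.supη0))

/-- `‖ξ^{-1/2} g e^{-sφ}‖_{L²(S)}` for a scalar or vector valued function `g`. -/
def wnorm (s lam : ℝ) (S : Set (G.Torus × ℝ × ℝ)) {F : Type*} [NormedAddCommGroup F]
    [NormedSpace ℝ F] (g : G.Torus × ℝ × ℝ → F) : ℝ≥0∞ :=
  eLpNorm (fun q => (W.xi lam q.1 q.2.2 ^ (-(1 / 2) : ℝ) *
    Real.exp (-s * W.phi lam q.1 q.2.2)) • g q) 2 (volume.restrict S)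

end WeightData

end TransportObs

end

/-! Along a characteristic `x = x₀ + u t` the equation is a scalar linear ODE, and `η⁰` is constant.
The weight `ξ^{-1/2} e^{-sφ}` therefore depends on time there only through `θ`, and it is
nonincreasing in `θ` for every `s, λ ≥ 1` (`weight_charPoint_le`). A characteristic avoids `ω` only
during a time interval of length at most `d/u` (`exists_charPoint_mem_omegaT`). Since `T - d/u > 2T₀
+ 2T₁`, this interval, if it meets `(0,T)`, has on one side an observed window of fixed length
towards which `θ` does not increase (`exists_window`). The ODE bounds the solution at an unobserved
time by its value at any time of the window plus the source in between. The weight does not decrease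
on the way, so it passes inside the integral. Averaging over the window gives the estimate on one
characteristic (`lintegral_le_of_window`), and Fubini gives (i), with a constant independent of `s`
and `λ`.

To apply this to weak solutions, they are identified with Duhamel's formula by duality
(`IsSolution.ae_eq_duhamel`). Every test function `ψ` in `Q` is the image under `∂ₜ + u∂ₓ + c` of an
admissible test function `dual G c ψ`, so `∫ σψ` is determined by the data. Fubini yields the same
value for Duhamel's formula, and test functions separate integrable functions.

The dual construction commutes with constant-coefficient derivatives. Hence each spatial derivative
of `σ` is Duhamel's formula for the differentiated data (`IsSolution.hasWeakDeriv`), and (ii) is the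
estimate of (i) applied to each component. Finally `∂ₜσ = cσ - f - u∂ₓσ`, so (iii) follows from (i)
and (ii). -/

noncomputable section

namespace TransportObs

/-! ### Test functions on the torus through their periodic lifts. -/

section TestFunctions

variable {G : Channel} {E : Type*}

/-- The lift of a function on `𝕋_L × E` to `ℝ × E`, periodic in the first variable. -/
def lift (χ : G.Torus × E → ℝ) (p : ℝ × E) : ℝ := χ ((p.1 : G.Torus), p.2)

/-- Lets continuity and pointwise identities descend from `ℝ × E` to `𝕋_L × E`; calculus is done on
lifts only. -/
theorem isOpenQuotientMap_coe_prod [TopologicalSpace E] :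
    IsOpenQuotientMap (fun p : ℝ × E => (((p.1 : ℝ) : G.Torus), p.2)) :=
  (QuotientAddGroup.isOpenQuotientMap_mk (N := AddSubgroup.zmultiples G.period)).prodMap
    IsOpenQuotientMap.id

theorem exists_coe_eq [TopologicalSpace E] (q : G.Torus × E) : ∃ p : ℝ × E, ((p.1 : G.Torus), p.2) = q :=
  isOpenQuotientMap_coe_prod.surjective q

theorem continuous_of_lift [TopologicalSpace E] {χ : G.Torus × E → ℝ} (h : Continuous (lift χ)) : Continuous χ :=
  isOpenQuotientMap_coe_prod.continuous_comp_iff.1 h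

variable [NormedAddCommGroup E] [NormedSpace ℝ E]

theorem dirDeriv_coe {χ : G.Torus × E → ℝ} (v : ℝ × E) {p : ℝ × E}
    (h : DifferentiableAt ℝ (lift χ) p) :
    dirDeriv G v χ ((p.1 : G.Torus), p.2) = fderiv ℝ (lift χ) p v := by
  have h1 : HasDerivAt (fun t : ℝ => p + t • v) v 0 := by
    simpa using ((hasDerivAt_id (0 : ℝ)).smul_const v).const_add p
  have h2 : HasFDerivAt (lift χ) (fderiv ℝ (lift χ) p) (p + (0 : ℝ) • v) := by
    simpa using h.hasFDerivAt
  have h3 := (h2.comp_hasDerivAt (0 : ℝ) h1).deriv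
  rw [← h3]
  unfold dirDeriv
  congr 1

namespace IsTest

variable {U V : Set (G.Torus × E)} {χ ψ : G.Torus × E → ℝ}

theorem contDiff_lift (h : IsTest G U χ) : ContDiff ℝ ∞ (lift χ) := h.smooth

theorem continuous (h : IsTest G U χ) : Continuous χ :=
  continuous_of_lift h.contDiff_lift.continuous

theorem differentiable_lift (h : IsTest G U χ) : Differentiable ℝ (lift χ) :=
  h.contDiff_lift.differentiable (by simp)

theorem mono (h : IsTest G U χ) (hUV : U ⊆ V) : IsTest G V χ :=
  ⟨h.smooth, h.compact, h.support_subset.trans hUV⟩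

theorem exists_bound (h : IsTest G U χ) : ∃ C, ∀ q, ‖χ q‖ ≤ C :=
  h.compact.exists_bound_of_continuous h.continuous

theorem of_support_subset {K : Set (G.Torus × E)} (h : ContDiff ℝ ∞ (lift χ)) (hK : IsCompact K)
    (hχ : Function.support χ ⊆ K) (hU : K ⊆ U) : IsTest G U χ :=
  ⟨h, HasCompactSupport.of_support_subset_isCompact hK hχ,
    (closure_minimal hχ hK.isClosed).trans hU⟩

theorem support_dirDeriv_subset (v : ℝ × E) :
    Function.support (dirDeriv G v χ) ⊆ tsupport χ := by
  intro q hq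
  by_contra hn
  apply hq
  have h0 : χ =ᶠ[nhds q] 0 := notMem_tsupport_iff_eventuallyEq.1 hn
  have hc : Filter.Tendsto
      (fun h : ℝ => (q.1 + ((h * v.1 : ℝ) : G.Torus), q.2 + h • v.2)) (nhds 0) (nhds q) := by
    have : Continuous (fun h : ℝ => (q.1 + ((h * v.1 : ℝ) : G.Torus), q.2 + h • v.2)) := by
      refine Continuous.prodMk (continuous_const.add ?_) (by fun_prop)
      exact (AddCircle.continuous_mk' _).comp (by fun_prop)
    simpa using this.tendsto 0
  have h1 := hc.eventually h0
  unfold dirDeriv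
  rw [Filter.EventuallyEq.deriv_eq (f := fun _ => (0 : ℝ)) h1]
  simp

theorem lift_dirDeriv (h : Differentiable ℝ (lift χ)) (v : ℝ × E) :
    lift (dirDeriv G v χ) = fun p => fderiv ℝ (lift χ) p v :=
  funext fun p => dirDeriv_coe v (h p)

theorem dirDeriv (h : IsTest G U χ) (v : ℝ × E) : IsTest G U (dirDeriv G v χ) := by
  refine of_support_subset ?_ h.compact (support_dirDeriv_subset v) h.support_subset
  rw [lift_dirDeriv h.differentiable_lift]
  exact (h.contDiff_lift.fderiv_right (m := ∞) (by simp)).clm_apply contDiff_const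

theorem dirDeriv_add (h : IsTest G U χ) (v w : ℝ × E) (q : G.Torus × E) :
    TransportObs.dirDeriv G (v + w) χ q =
      TransportObs.dirDeriv G v χ q + TransportObs.dirDeriv G w χ q := by
  obtain ⟨p, rfl⟩ := exists_coe_eq q
  simp only [dirDeriv_coe _ (h.differentiable_lift p), map_add]

theorem dirDeriv_smul (h : IsTest G U χ) (a : ℝ) (v : ℝ × E) (q : G.Torus × E) :
    TransportObs.dirDeriv G (a • v) χ q = a * TransportObs.dirDeriv G v χ q := by
  obtain ⟨p, rfl⟩ := exists_coe_eq q
  simp only [dirDeriv_coe _ (h.differentiable_lift p), map_smul, smul_eq_mul]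

theorem measurable [MeasurableSpace E] [BorelSpace E] (h : IsTest G U χ) :
    Measurable χ := h.continuous.measurable

end IsTest

end TestFunctions

/-! ### Averages along segments: smoothness and derivatives. -/

section Average

/-- The weighted average of `Ψ` along the segment `p - [0,T] v`. -/
def lineAverage {P E : Type*} [NormedAddCommGroup P] [NormedSpace ℝ P] [NormedAddCommGroup E]
    [NormedSpace ℝ E] (c T : ℝ) (v : P) (Ψ : P → E) (p : P) : E :=
  ∫ r in (0 : ℝ)..T, Real.exp (-c * r) • Ψ (p - r • v)

variable {P E : Type} [NormedAddCommGroup P] [NormedSpace ℝ P] [FiniteDimensional ℝ P]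
  [NormedAddCommGroup E] [NormedSpace ℝ E] {c T : ℝ} {v : P} {Ψ : P → E}

theorem hasFDerivAt_lineAverage (h : ContDiff ℝ 1 Ψ) (p : P) :
    HasFDerivAt (lineAverage c T v Ψ) (lineAverage c T v (fderiv ℝ Ψ) p) p := by
  have hc : Continuous Ψ := h.continuous
  have hc' : Continuous (fderiv ℝ Ψ) := h.continuous_fderiv (by simp)
  -- In finite dimension the unit ball times the segment is compact, which supplies a constant
  -- dominating function for differentiation under the integral.
  have hK : IsCompact (Metric.closedBall p 1 ×ˢ uIcc 0 T) :=
    (isCompact_closedBall p 1).prod isCompact_uIcc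
  obtain ⟨B, hB⟩ := hK.exists_bound_of_continuousOn
    (f := fun y : P × ℝ => Real.exp (-c * y.2) • fderiv ℝ Ψ (y.1 - y.2 • v))
    (by fun_prop)
  refine intervalIntegral.hasFDerivAt_integral_of_dominated_of_fderiv_le
    (F' := fun x r => Real.exp (-c * r) • fderiv ℝ Ψ (x - r • v)) (bound := fun _ => B)
    (Metric.ball_mem_nhds p one_pos) ?_ ?_ ?_ ?_ ?_ ?_
  · exact Filter.Eventually.of_forall fun x =>
      (by fun_prop : Continuous fun r : ℝ => Real.exp (-c * r) • Ψ (x - r • v)).aestronglyMeasurable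
  · exact (by fun_prop : Continuous fun r : ℝ =>
      Real.exp (-c * r) • Ψ (p - r • v)).intervalIntegrable _ _
  · exact (by fun_prop : Continuous fun r : ℝ =>
      Real.exp (-c * r) • fderiv ℝ Ψ (p - r • v)).aestronglyMeasurable
  · exact Filter.Eventually.of_forall fun r hr x hx =>
      hB (x, r) ⟨Metric.ball_subset_closedBall hx, uIoc_subset_uIcc hr⟩
  · exact intervalIntegrable_const
  · refine Filter.Eventually.of_forall fun r hr x hx => ?_
    have h1 := ((h.differentiable (by simp)) (x - r • v)).hasFDerivAt
    have h2 : HasFDerivAt (fun y : P => y - r • v) (ContinuousLinearMap.id ℝ P) x :=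
      (hasFDerivAt_id x).sub_const _
    exact (h1.comp x h2).const_smul _

theorem fderiv_lineAverage (h : ContDiff ℝ 1 Ψ) :
    fderiv ℝ (lineAverage c T v Ψ) = lineAverage c T v (fderiv ℝ Ψ) :=
  funext fun p => (hasFDerivAt_lineAverage h p).fderiv

theorem fderiv_lineAverage_apply (h : ContDiff ℝ 1 Ψ) (p w : P) :
    fderiv ℝ (lineAverage c T v Ψ) p w = lineAverage c T v (fun x => fderiv ℝ Ψ x w) p := by
  have hc' : Continuous (fderiv ℝ Ψ) := h.continuous_fderiv (by simp)
  rw [fderiv_lineAverage h]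
  unfold lineAverage
  rw [ContinuousLinearMap.intervalIntegral_apply
    ((by fun_prop : Continuous fun r : ℝ =>
      Real.exp (-c * r) • fderiv ℝ Ψ (p - r • v)).intervalIntegrable _ _)]
  rfl

/-- Differentiation commutes with averaging, so the derivative is again an average, now with values
in `P →L[ℝ] E`. The induction must therefore let the target space vary. -/
theorem contDiff_nat_lineAverage (n : ℕ) : ∀ {E : Type} [NormedAddCommGroup E] [NormedSpace ℝ E]
    {Ψ : P → E}, ContDiff ℝ ∞ Ψ → ContDiff ℝ n (lineAverage c T v Ψ) := by
  induction n with
  | zero =>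
    intro E _ _ Ψ h
    have h1 : ContDiff ℝ 1 Ψ := h.of_le (by exact_mod_cast le_top)
    exact contDiff_zero.2 (continuous_iff_continuousAt.2 fun p =>
      (hasFDerivAt_lineAverage h1 p).continuousAt)
  | succ n ih =>
    intro E _ _ Ψ h
    have h1 : ContDiff ℝ 1 Ψ := h.of_le (by exact_mod_cast le_top)
    push_cast
    refine contDiff_succ_iff_fderiv.2 ⟨fun p => (hasFDerivAt_lineAverage h1 p).differentiableAt,
      by simp, ?_⟩
    rw [fderiv_lineAverage h1]
    exact ih (h.fderiv_right (by simp))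

theorem ContDiff.lineAverage (h : ContDiff ℝ ∞ Ψ) : ContDiff ℝ ∞ (lineAverage c T v Ψ) :=
  contDiff_infty.2 fun n => contDiff_nat_lineAverage n h

/-- The derivative of a line average along its own direction. -/
theorem fderiv_lineAverage_self {Ψ : P → ℝ} (h : ContDiff ℝ 1 Ψ) (p : P) :
    fderiv ℝ (lineAverage c T v Ψ) p v + c * lineAverage c T v Ψ p =
      Ψ p - Real.exp (-c * T) * Ψ (p - T • v) := by
  have hc : Continuous Ψ := h.continuous
  have hc' : Continuous (fderiv ℝ Ψ) := h.continuous_fderiv (by simp)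
  -- The left-hand side is the integral of an exact derivative in `r`.
  have hd : ∀ r ∈ uIcc 0 T, HasDerivAt (fun r : ℝ => -(Real.exp (-c * r) * Ψ (p - r • v)))
      (Real.exp (-c * r) * fderiv ℝ Ψ (p - r • v) v +
        c * (Real.exp (-c * r) * Ψ (p - r • v))) r := by
    intro r _
    have h1 : HasDerivAt (fun r : ℝ => p - r • v) (-v) r := by
      simpa using ((hasDerivAt_id r).smul_const v).const_sub p
    have h2 := ((h.differentiable (by simp)) (p - r • v)).hasFDerivAt.comp_hasDerivAt r h1
    have h3 : HasDerivAt (fun r : ℝ => Real.exp (-c * r)) (Real.exp (-c * r) * -c) r := by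
      simpa using ((hasDerivAt_id r).const_mul (-c)).exp
    refine (h3.mul h2).neg.congr_deriv ?_
    simp only [Function.comp_apply, map_neg]
    ring
  have i1 : IntervalIntegrable (fun r : ℝ => Real.exp (-c * r) * fderiv ℝ Ψ (p - r • v) v)
      volume 0 T := Continuous.intervalIntegrable (by fun_prop) _ _
  have i2 : IntervalIntegrable (fun r : ℝ => c * (Real.exp (-c * r) * Ψ (p - r • v)))
      volume 0 T := Continuous.intervalIntegrable (by fun_prop) _ _
  have hi := intervalIntegral.integral_eq_sub_of_hasDerivAt hd (i1.add i2)
  rw [intervalIntegral.integral_add i1 i2, intervalIntegral.integral_const_mul] at hi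
  rw [fderiv_lineAverage_apply h]
  simp only [lineAverage, smul_eq_mul]
  rw [hi]
  simp
  ring

end Average

/-! ### The dual transport problem. -/

section Dual

variable (G : Channel)

/-- The half-open cylinder on which the test functions of the weak formulation live. -/
def Channel.Qpos : Set (G.Torus × ℝ × ℝ) := {q | q.2.1 ∈ Ioo (0 : ℝ) 1 ∧ 0 < q.2.2}

theorem Channel.Q_subset_Qpos : G.Q ⊆ G.Qpos := fun _ hq => ⟨hq.1, hq.2.1⟩

/-- The displacement along the characteristics during the time `r`. -/
def flow (r : ℝ) : G.Torus × ℝ × ℝ := (((G.u * r : ℝ) : G.Torus), 0, r)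

theorem continuous_flow : Continuous (flow G) := by
  refine Continuous.prodMk ((AddCircle.continuous_mk' _).comp (by fun_prop)) (by fun_prop)

@[simp] theorem flow_snd_fst (r : ℝ) : (flow G r).2.1 = 0 := rfl
@[simp] theorem flow_snd_snd (r : ℝ) : (flow G r).2.2 = r := rfl

/-- The solution of the dual problem `∂ₜχ + u ∂ₓχ + c χ = ψ` vanishing for small times. -/
def dual (c : ℝ) (ψ : G.Torus × ℝ × ℝ → ℝ) (q : G.Torus × ℝ × ℝ) : ℝ :=
  ∫ r in (0 : ℝ)..G.T, Real.exp (-c * r) * ψ (q - flow G r)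

variable {G} {c : ℝ} {ψ : G.Torus × ℝ × ℝ → ℝ}

theorem lift_dual : lift (dual G c ψ) = lineAverage c G.T (G.u, 0, 1) (lift ψ) := by
  funext p
  simp [lift, dual, lineAverage, flow, Prod.sub_def, mul_comm]

/-- The support of `ψ` is only moved forward in time, by at most `T`. This keeps the support compact
and away from `t = 0`, though it may reach `t = T` and beyond. -/
theorem support_dual_subset :
    Function.support (dual G c ψ) ⊆
      (fun y : ℝ × (G.Torus × ℝ × ℝ) => y.2 + flow G y.1) '' (Icc 0 G.T ×ˢ tsupport ψ) := by
  intro q hq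
  by_contra hn
  apply hq
  unfold dual
  rw [intervalIntegral.integral_congr (g := fun _ => 0)]
  · simp
  · intro r hr
    rw [uIcc_of_le G.T_pos.le] at hr
    have : ψ (q - flow G r) = 0 := by
      by_contra h0
      exact hn ⟨(r, q - flow G r), ⟨hr, subset_tsupport _ h0⟩, by simp⟩
    simp [this]

theorem IsTest.dual (h : IsTest G G.Q ψ) (c : ℝ) : IsTest G G.Qpos (dual G c ψ) := by
  refine IsTest.of_support_subset ?_ ((isCompact_Icc.prod h.compact.isCompact).image ?_)
    support_dual_subset ?_
  · rw [lift_dual]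
    exact ContDiff.lineAverage h.contDiff_lift
  · exact continuous_snd.add ((continuous_flow G).comp continuous_fst)
  · rintro _ ⟨⟨r, q⟩, ⟨hr, hq⟩, rfl⟩
    have hq' := h.support_subset hq
    refine ⟨by simpa using hq'.1, ?_⟩
    have := hq'.2.1
    have := hr.1
    simp only [Prod.snd_add, flow_snd_snd]
    linarith

theorem IsTest.dirDeriv_dual (h : IsTest G G.Q ψ) (v : ℝ × ℝ × ℝ) :
    TransportObs.dirDeriv G v (TransportObs.dual G c ψ) =
      TransportObs.dual G c (TransportObs.dirDeriv G v ψ) := by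
  funext q
  obtain ⟨p, rfl⟩ := exists_coe_eq q
  have h1 : ContDiff ℝ 1 (lift ψ) := h.contDiff_lift.of_le (by exact_mod_cast le_top)
  rw [dirDeriv_coe v ((h.dual c).differentiable_lift p), lift_dual,
    fderiv_lineAverage_apply h1, ← IsTest.lift_dirDeriv h.differentiable_lift, ← lift_dual]
  rfl

/-- Differentiating the average along the flow leaves the boundary term `ψ (q - flow G G.T)`. It
vanishes for `t ≤ T` because that point has nonpositive time. -/
theorem IsTest.dual_eq (h : IsTest G G.Q ψ) (c : ℝ) {q : G.Torus × ℝ × ℝ} (hq : q.2.2 ≤ G.T) :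
    TransportObs.dirDeriv G (0, (0, 1)) (TransportObs.dual G c ψ) q +
      G.u * TransportObs.dirDeriv G (1, (0, 0)) (TransportObs.dual G c ψ) q +
      c * TransportObs.dual G c ψ q = ψ q := by
  have h1 : ContDiff ℝ 1 (lift ψ) := h.contDiff_lift.of_le (by exact_mod_cast le_top)
  have hv : ((G.u, 0, 1) : ℝ × ℝ × ℝ) = (0, (0, 1)) + G.u • (1, (0, 0)) := by simp
  rw [← (h.dual c).dirDeriv_smul, ← (h.dual c).dirDeriv_add, ← hv]
  obtain ⟨p, rfl⟩ := exists_coe_eq q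
  rw [dirDeriv_coe _ ((h.dual c).differentiable_lift p)]
  have h2 := fderiv_lineAverage_self (c := c) (T := G.T) (v := ((G.u, 0, 1) : ℝ × ℝ × ℝ)) h1 p
  rw [← lift_dual] at h2
  have h3 : lift ψ (p - G.T • (G.u, 0, 1)) = 0 := by
    by_contra h0
    have := (h.support_subset (subset_tsupport _ h0)).2.1
    simp at this hq
    linarith
  rw [h3, mul_zero, sub_zero] at h2
  exact h2

/-- The value of the dual solution at the final time. -/
theorem dual_final (p : G.Torus × ℝ) :
    dual G c ψ (p.1, p.2, G.T) = ∫ t in (0 : ℝ)..G.T,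
      Real.exp (-c * (G.T - t)) * ψ (p.1 - ((G.u * (G.T - t) : ℝ) : G.Torus), p.2, t) := by
  have := intervalIntegral.integral_comp_sub_left (a := 0) (b := G.T)
    (fun r => Real.exp (-c * r) * ψ ((p.1, p.2, G.T) - flow G r)) G.T
  rw [sub_self, sub_zero] at this
  rw [dual, ← this]
  simp [flow, Prod.sub_def]

end Dual

/-! ### Time slices and time cutoffs of test functions. -/

section Slices

variable {G : Channel} {χ : G.Torus × ℝ × ℝ → ℝ}

/-- The restriction of a test function to a fixed time. -/
def atTime (t : ℝ) (χ : G.Torus × ℝ × ℝ → ℝ) (p : G.Torus × ℝ) : ℝ := χ (p.1, p.2, t)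

theorem IsTest.atTime (h : IsTest G G.Qpos χ) (t : ℝ) : IsTest G G.Omega (atTime t χ) := by
  refine IsTest.of_support_subset (K := (fun q : G.Torus × ℝ × ℝ => (q.1, q.2.1)) '' tsupport χ)
    ?_ (h.compact.isCompact.image (by fun_prop)) ?_ ?_
  · exact h.contDiff_lift.comp (by fun_prop : ContDiff ℝ ∞ fun p : ℝ × ℝ => (p.1, p.2, t))
  · intro p hp
    exact ⟨(p.1, p.2, t), subset_tsupport _ hp, rfl⟩
  · rintro _ ⟨q, hq, rfl⟩
    exact (h.support_subset hq).1

theorem dirDeriv_atTime (t : ℝ) (v : ℝ × ℝ) :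
    dirDeriv G v (atTime t χ) = atTime t (dirDeriv G (v.1, (v.2, 0)) χ) := by
  funext p
  simp [dirDeriv, atTime]

/-- Multiplication of a test function by a cutoff in time. -/
theorem IsTest.mul_time {κ : ℝ → ℝ} (h : IsTest G G.Qpos χ) (hκ : ContDiff ℝ ∞ κ) {T' : ℝ}
    (hT' : T' < G.T) (hκ0 : ∀ t, T' < t → κ t = 0) :
    IsTest G G.Q (fun q => κ q.2.2 * χ q) := by
  refine IsTest.of_support_subset (K := tsupport χ ∩ {q | q.2.2 ≤ T'})
    ?_ (h.compact.isCompact.inter_right (isClosed_le (by fun_prop) continuous_const)) ?_ ?_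
  · exact (hκ.comp (by fun_prop : ContDiff ℝ ∞ fun p : ℝ × ℝ × ℝ => p.2.2)).mul h.contDiff_lift
  · intro q hq
    refine ⟨subset_tsupport _ (right_ne_zero_of_mul hq), ?_⟩
    by_contra hn
    exact left_ne_zero_of_mul hq (hκ0 _ (not_le.1 hn))
  · rintro q ⟨hq, hq'⟩
    have := h.support_subset hq
    exact ⟨this.1, this.2, lt_of_le_of_lt hq' hT'⟩

theorem dirDeriv_mul_time (κ : ℝ → ℝ) (v : ℝ × ℝ) (q : G.Torus × ℝ × ℝ) :
    dirDeriv G (v.1, (v.2, 0)) (fun q => κ q.2.2 * χ q) q =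
      κ q.2.2 * dirDeriv G (v.1, (v.2, 0)) χ q := by
  simp [dirDeriv]

end Slices

/-! ### Product structure of the measures, and integrability. -/

section Measures

variable (G : Channel)

/-- Lebesgue measure on the rectangle `(0,1) × (0,T)`. -/
def stripMeasure : Measure (ℝ × ℝ) :=
  (volume.restrict (Ioo (0 : ℝ) 1)).prod (volume.restrict (Ioo (0 : ℝ) G.T))

instance : IsFiniteMeasure (stripMeasure G) := by unfold stripMeasure; infer_instance

theorem stripMeasure_eq : stripMeasure G = volume.restrict (Ioo (0 : ℝ) 1 ×ˢ Ioo (0 : ℝ) G.T) := by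
  rw [stripMeasure, Measure.prod_restrict, Measure.volume_eq_prod]

theorem Channel.Q_eq : G.Q = univ ×ˢ (Ioo (0 : ℝ) 1 ×ˢ Ioo (0 : ℝ) G.T) := by
  ext q; simp [Channel.Q]

theorem Channel.Omega_eq : G.Omega = univ ×ˢ Ioo (0 : ℝ) 1 := by
  ext q; simp [Channel.Omega]

theorem Channel.measurableSet_Q : MeasurableSet G.Q := by
  rw [G.Q_eq]; exact MeasurableSet.univ.prod (measurableSet_Ioo.prod measurableSet_Ioo)

theorem Channel.measurableSet_Omega : MeasurableSet G.Omega := by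
  rw [G.Omega_eq]; exact MeasurableSet.univ.prod measurableSet_Ioo

theorem restrict_Q : volume.restrict G.Q = (volume : Measure G.Torus).prod (stripMeasure G) := by
  rw [G.Q_eq, stripMeasure_eq, Measure.volume_eq_prod, ← Measure.prod_restrict,
    Measure.restrict_univ]

theorem restrict_Omega :
    volume.restrict G.Omega = (volume : Measure G.Torus).prod (volume.restrict (Ioo (0 : ℝ) 1)) := by
  rw [G.Omega_eq, Measure.volume_eq_prod, ← Measure.prod_restrict, Measure.restrict_univ]

instance : IsFiniteMeasure ((volume : Measure (G.Torus × ℝ × ℝ)).restrict G.Q) := by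
  rw [restrict_Q]; infer_instance

instance : IsFiniteMeasure ((volume : Measure (G.Torus × ℝ)).restrict G.Omega) := by
  rw [restrict_Omega]; infer_instance

end Measures

section Integrability

variable {G : Channel}

theorem integrable_of_memLp_two {α F : Type*} [MeasurableSpace α] [NormedAddCommGroup F]
    {μ : Measure α} [IsFiniteMeasure μ] {f : α → F} (h : MemLp f 2 μ) : Integrable f μ :=
  h.integrable (by norm_num)

theorem IsTest.integrable_mul {E : Type*} [NormedAddCommGroup E] [NormedSpace ℝ E]
    [MeasurableSpace E] [BorelSpace E] {U : Set (G.Torus × E)} {χ f : G.Torus × E → ℝ}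
    {μ : Measure (G.Torus × E)} (h : IsTest G U χ) (hf : Integrable f μ) :
    Integrable (fun q => f q * χ q) μ := by
  obtain ⟨C, hC⟩ := h.exists_bound
  exact hf.mul_bdd h.measurable.aestronglyMeasurable (Filter.Eventually.of_forall hC)

end Integrability

/-! ### Removing the vanishing condition at the final time. -/

section Cutoff

variable {G : Channel}

/-- A smooth cutoff in time which vanishes near `T` and converges to `1` on `(-∞, T)`. -/
def cutoff (T : ℝ) (n : ℕ) (t : ℝ) : ℝ := Real.smoothTransition ((n + 1) * (T - t) - 1)

theorem contDiff_cutoff (T : ℝ) (n : ℕ) : ContDiff ℝ ∞ (cutoff T n) :=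
  Real.smoothTransition.contDiff.comp (by fun_prop)

theorem cutoff_eq_zero {T t : ℝ} {n : ℕ} (h : T - 1 / (n + 1) < t) : cutoff T n t = 0 := by
  apply Real.smoothTransition.zero_of_nonpos
  have hn : (0 : ℝ) < n + 1 := by positivity
  have : T - t < 1 / (n + 1) := by linarith
  have := (lt_div_iff₀ hn).1 this
  linarith

theorem tendsto_cutoff {T t : ℝ} (h : t < T) :
    Filter.Tendsto (fun n => cutoff T n t) Filter.atTop (nhds 1) := by
  apply tendsto_const_nhds.congr'
  -- The cutoff equals `1` as soon as `T - t ≥ 2 / (n + 1)`.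
  obtain ⟨N, hN⟩ := exists_nat_gt (2 / (T - t))
  filter_upwards [Filter.eventually_ge_atTop N] with n hn
  symm
  apply Real.smoothTransition.one_of_one_le
  have h0 : 0 < T - t := by linarith
  have h1 := (div_lt_iff₀ h0).1 hN
  have h2 : (N : ℝ) ≤ n := by exact_mod_cast hn
  nlinarith

theorem tendsto_integral_cutoff {F : G.Torus × ℝ × ℝ → ℝ}
    (hF : Integrable F (volume.restrict G.Q)) :
    Filter.Tendsto (fun n => ∫ q in G.Q, cutoff G.T n q.2.2 * F q) Filter.atTop
      (nhds (∫ q in G.Q, F q)) := by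
  refine tendsto_integral_of_dominated_convergence (fun q => ‖F q‖) ?_ hF.norm ?_ ?_
  · intro n
    exact ((contDiff_cutoff G.T n).continuous.measurable.comp
      (measurable_snd.comp measurable_snd)).aestronglyMeasurable.mul hF.aestronglyMeasurable
  · intro n
    refine Filter.Eventually.of_forall fun q => ?_
    rw [norm_mul, Real.norm_eq_abs, cutoff, abs_of_nonneg (Real.smoothTransition.nonneg _)]
    exact mul_le_of_le_one_left (norm_nonneg _) (Real.smoothTransition.le_one _)
  · filter_upwards [ae_restrict_mem G.measurableSet_Q] with q hq
    simpa using (tendsto_cutoff hq.2.2).mul_const (F q)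

/-- A weak spatial derivative may be tested with functions which do not vanish at `t = T`. -/
theorem HasWeakDeriv.integral_Qpos {v : ℝ × ℝ} {f g χ : G.Torus × ℝ × ℝ → ℝ}
    (h : HasWeakDeriv G G.Q (v.1, (v.2, 0)) f g) (hf : Integrable f (volume.restrict G.Q))
    (hg : Integrable g (volume.restrict G.Q)) (hχ : IsTest G G.Qpos χ) :
    ∫ q in G.Q, f q * dirDeriv G (v.1, (v.2, 0)) χ q = - ∫ q in G.Q, g q * χ q := by
  refine tendsto_nhds_unique
    (tendsto_integral_cutoff ((hχ.dirDeriv (v.1, (v.2, 0))).integrable_mul hf))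
    (((tendsto_integral_cutoff (hχ.integrable_mul hg)).neg).congr fun n => ?_)
  have hn : (0 : ℝ) < 1 / (n + 1) := by positivity
  -- The cutoff depends on time alone, so no spatial derivative falls on it and dominated
  -- convergence suffices on both sides.
  have := h _ (hχ.mul_time (contDiff_cutoff G.T n) (T' := G.T - 1 / (n + 1)) (by linarith)
    fun t ht => cutoff_eq_zero ht)
  simp only [dirDeriv_mul_time] at this
  simp only [mul_left_comm (cutoff _ _ _)]
  exact this.symm

end Cutoff

/-! ### Test functions separate integrable functions. -/

section Density

variable {G : Channel}

/-- The periodic extension of a function supported in a fundamental strip. -/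
def periodize (G : Channel) {E : Type*} (g : ℝ × E → ℝ) (q : G.Torus × E) : ℝ :=
  g ((AddCircle.equivIoc G.period (-G.L) q.1 : ℝ), q.2)

theorem periodize_coe {E : Type*} (g : ℝ × E → ℝ) {x : ℝ} {e : E}
    (hx : x ∈ Ioc (-G.L) (-G.L + G.period)) :
    periodize G g ((x : G.Torus), e) = g (x, e) := by
  rw [periodize, AddCircle.equivIoc_coe_of_mem hx]

theorem contDiff_lift_periodize {E : Type*} [NormedAddCommGroup E] [NormedSpace ℝ E]
    {g : ℝ × E → ℝ} (hg : ContDiff ℝ ∞ g)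
    (h0 : ∀ p : ℝ × E, p.1 ∉ Ioo (-G.L) (-G.L + G.period) → g p = 0) :
    ContDiff ℝ ∞ (lift (periodize G g)) := by
  have hP : 0 < G.period := Fact.out
  rw [contDiff_iff_contDiffAt]
  intro p
  obtain ⟨n, hn, -⟩ := existsUnique_add_zsmul_mem_Ioc hP p.1 (-G.L)
  -- After a shift by `n` periods the first coordinate lies in two consecutive fundamental
  -- intervals. There the lift is the sum of two translates of `g`, at most one of them nonzero,
  -- also across the junction.
  have hev : lift (periodize G g) =ᶠ[nhds p]
      fun p => g (p.1 + n • G.period, p.2) + g (p.1 + n • G.period - G.period, p.2) := by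
    have ho : ∀ᶠ y : ℝ × E in nhds p,
        y.1 + n • G.period ∈ Ioo (-G.L) (-G.L + G.period + G.period) :=
      (by fun_prop : Continuous fun y : ℝ × E => y.1 + n • G.period).continuousAt
        (Ioo_mem_nhds hn.1 (by linarith [hn.2]))
    filter_upwards [ho] with y hy
    obtain ⟨x, e⟩ := y
    set s := x + n • G.period with hs
    by_cases hle : s ≤ -G.L + G.period
    · have hc : (x : G.Torus) = (s : G.Torus) := by
        rw [hs, AddCircle.coe_add, AddCircle.coe_zsmul]; simp [AddCircle.coe_period]
      rw [lift, hc, periodize_coe g ⟨hy.1, hle⟩,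
        h0 (s - G.period, e) (fun h => by have := h.1; simp only at this; linarith), add_zero]
    · have hc : (x : G.Torus) = ((s - G.period : ℝ) : G.Torus) := by
        rw [hs, AddCircle.coe_sub, AddCircle.coe_add, AddCircle.coe_zsmul]
        simp [AddCircle.coe_period]
      have h2 := hy.2
      rw [lift, hc, periodize_coe g ⟨by linarith, by linarith⟩,
        h0 (s, e) (fun h => by have := h.2; simp only at this; linarith), zero_add]
  refine ContDiffAt.congr_of_eventuallyEq ?_ hev
  exact (ContDiff.add (hg.comp (by fun_prop)) (hg.comp (by fun_prop))).contDiffAt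

theorem isTest_periodize {g : ℝ × ℝ × ℝ → ℝ} (hg : ContDiff ℝ ∞ g) (hc : HasCompactSupport g)
    (hs : tsupport g ⊆
      Ioo (-G.L) (-G.L + G.period) ×ˢ (Ioo (0 : ℝ) 1 ×ˢ Ioo (0 : ℝ) G.T)) :
    IsTest G G.Q (periodize G g) := by
  refine IsTest.of_support_subset
    (K := (fun p : ℝ × ℝ × ℝ => ((p.1 : G.Torus), p.2)) '' tsupport g)
    (contDiff_lift_periodize hg fun p hp => ?_) (hc.isCompact.image ?_) ?_ ?_
  · by_contra h
    exact hp (hs (subset_tsupport _ h)).1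
  · exact isOpenQuotientMap_coe_prod.continuous
  · rintro ⟨x, e⟩ hq
    exact ⟨_, subset_tsupport _ hq, by simp [AddCircle.coe_equivIoc]⟩
  · rintro _ ⟨p, hp, rfl⟩
    exact (hs hp).2

theorem measurePreserving_coe_prod (ν : Measure (ℝ × ℝ)) [SFinite ν] :
    MeasurePreserving (fun p : ℝ × ℝ × ℝ => ((p.1 : G.Torus), p.2))
      ((volume.restrict (Ioc (-G.L) (-G.L + G.period))).prod ν)
      ((volume : Measure G.Torus).prod ν) :=
  (AddCircle.measurePreserving_mk G.period (-G.L)).prod (MeasurePreserving.id ν)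

/-- Test functions in `Q` are dense enough to identify integrable functions. -/
theorem ae_eq_zero_of_forall_isTest {h : G.Torus × ℝ × ℝ → ℝ}
    (hi : Integrable h (volume.restrict G.Q))
    (h0 : ∀ ψ, IsTest G G.Q ψ → ∫ q in G.Q, h q * ψ q = 0) :
    ∀ᵐ q ∂volume.restrict G.Q, h q = 0 := by
  have hmp := measurePreserving_coe_prod (G := G) (stripMeasure G)
  rw [← restrict_Q] at hmp
  -- Cutting the torus at one point removes a null set, so it is enough to use the separation
  -- theorem for smooth functions on this open box of `ℝ³`.
  set U : Set (ℝ × ℝ × ℝ) :=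
    Ioo (-G.L) (-G.L + G.period) ×ˢ (Ioo (0 : ℝ) 1 ×ˢ Ioo (0 : ℝ) G.T) with hU
  have hUo : IsOpen U := isOpen_Ioo.prod (isOpen_Ioo.prod isOpen_Ioo)
  have hμ : (volume.restrict (Ioc (-G.L) (-G.L + G.period))).prod (stripMeasure G) =
      volume.restrict U := by
    rw [restrict_Ioo_eq_restrict_Ioc.symm, stripMeasure_eq, Measure.prod_restrict, hU,
      Measure.volume_eq_prod ℝ (ℝ × ℝ)]
  rw [hμ] at hmp
  have hiU : IntegrableOn (lift h) U := hmp.integrable_comp_of_integrable hi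
  have hz := hUo.ae_eq_zero_of_integral_contDiff_smul_eq_zero (μ := volume)
    hiU.locallyIntegrableOn (fun g hg hc hs => by
      have h1 := h0 _ (isTest_periodize hg hc hs)
      rw [← hmp.map_eq, integral_map hmp.measurable.aemeasurable] at h1
      · rw [← h1, ← setIntegral_eq_integral_of_forall_compl_eq_zero (s := U)]
        · refine setIntegral_congr_fun hUo.measurableSet fun p hp => ?_
          rw [periodize_coe g (Ioo_subset_Ioc_self hp.1), mul_comm]
          rfl
        · intro p hp
          have : g p = 0 := by
            by_contra hgp
            exact hp (hs (subset_tsupport _ hgp))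
          simp [this]
      · rw [hmp.map_eq]
        exact ((isTest_periodize hg hc hs).integrable_mul hi).aestronglyMeasurable)
  have hN : NullMeasurableSet {q | h q ≠ 0} (volume.restrict G.Q) :=
    (hi.aestronglyMeasurable.nullMeasurableSet_eq_fun
      aestronglyMeasurable_zero).compl
  rw [ae_iff, ← hmp.measure_preimage hN, Measure.restrict_apply₀ (hN.preimage
    hmp.quasiMeasurePreserving)]
  rw [ae_iff] at hz
  refine measure_mono_null ?_ hz
  rintro p ⟨hp, hpU⟩
  simpa using ⟨hpU, hp⟩

end Density

/-! ### Measure-theoretic tools. -/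

section Generalities

/-- The Cauchy-Schwarz inequality for the product of a function with `1`. -/
theorem sq_lintegral_le {α : Type*} [MeasurableSpace α] {μ : Measure α} {f : α → ℝ≥0∞}
    (hf : AEMeasurable f μ) : (∫⁻ a, f a ∂μ) ^ 2 ≤ μ univ * ∫⁻ a, f a ^ 2 ∂μ := by
  have h := ENNReal.lintegral_mul_le_Lp_mul_Lq μ (p := 2) (q := 2) ⟨by norm_num, by norm_num,
    by norm_num⟩ hf (aemeasurable_const (b := (1 : ℝ≥0∞)))
  simp only [Pi.mul_apply, mul_one, ENNReal.one_rpow, lintegral_const, one_mul] at h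
  calc (∫⁻ a, f a ∂μ) ^ 2
      ≤ ((∫⁻ a, f a ^ (2 : ℝ) ∂μ) ^ (1 / 2 : ℝ) * (μ univ) ^ (1 / 2 : ℝ)) ^ 2 := by gcongr
    _ = μ univ * ∫⁻ a, f a ^ 2 ∂μ := by
      rw [mul_pow, ← ENNReal.rpow_natCast, ← ENNReal.rpow_natCast, ← ENNReal.rpow_mul,
        ← ENNReal.rpow_mul, mul_comm]
      norm_num

/-- A shear by a measurable shift preserves product measures. -/
theorem measurePreserving_shear {A B : Type*} [AddGroup A] [MeasurableSpace A] [MeasurableAdd₂ A]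
    [MeasurableSpace B] (μ : Measure A) [SFinite μ] [μ.IsAddRightInvariant] (ν : Measure B)
    [SFinite ν] {φ : B → A} (hφ : Measurable φ) :
    MeasurePreserving (fun p : A × B => (p.1 + φ p.2, p.2)) (μ.prod ν) (μ.prod ν) := by
  have h1 : MeasurePreserving (fun p : B × A => (p.1, p.2 + φ p.1)) (ν.prod μ) (ν.prod μ) :=
    (MeasurePreserving.id ν).skew_product (g := fun b a => a + φ b)
      (measurable_snd.add (hφ.comp measurable_fst))
      (Filter.Eventually.of_forall fun b => map_add_right_eq_self μ (φ b))
  exact (Measure.measurePreserving_swap.comp h1).comp Measure.measurePreserving_swap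

theorem memLp_two_iff_lintegral {α F : Type*} [MeasurableSpace α] [NormedAddCommGroup F]
    {μ : Measure α} {f : α → F} (hf : AEStronglyMeasurable f μ) :
    MemLp f 2 μ ↔ ∫⁻ a, ‖f a‖ₑ ^ 2 ∂μ < ⊤ := by
  rw [MemLp, and_iff_right hf, eLpNorm_lt_top_iff_lintegral_rpow_enorm_lt_top (by norm_num)
    (by norm_num)]
  norm_num

end Generalities

/-! ### Duhamel's formula: integrability and pairing with test functions. -/

section Duhamel

variable (G : Channel)

/-- The contribution of the source term to the solution of the transport equation. -/
def sourceTerm (c : ℝ) (f : G.Torus × ℝ × ℝ → ℝ) (q : G.Torus × ℝ × ℝ) : ℝ :=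
  ∫ r in Ioc (0 : ℝ) G.T, Real.exp (-c * r) * f (q + flow G r)

/-- The contribution of the final value to the solution of the transport equation. -/
def finalTerm (c : ℝ) (σT : G.Torus × ℝ → ℝ) (q : G.Torus × ℝ × ℝ) : ℝ :=
  Real.exp (-c * (G.T - q.2.2)) * σT (q.1 + ((G.u * (G.T - q.2.2) : ℝ) : G.Torus), q.2.1)

/-- Duhamel's formula for the solution of the transport equation. -/
def duhamel (c : ℝ) (σT : G.Torus × ℝ → ℝ) (f : G.Torus × ℝ × ℝ → ℝ)
    (q : G.Torus × ℝ × ℝ) : ℝ :=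
  finalTerm G c σT q + sourceTerm G c f q

variable {G} {c : ℝ} {σT : G.Torus × ℝ → ℝ} {f : G.Torus × ℝ × ℝ → ℝ}

theorem measurable_torus_coe {α : Type*} [MeasurableSpace α] {h : α → ℝ} (hh : Measurable h) :
    Measurable fun a => ((h a : ℝ) : G.Torus) :=
  (AddCircle.continuous_mk' G.period).measurable.comp hh

theorem exp_neg_mul_le {c r T : ℝ} (h0 : 0 ≤ r) (hr : r ≤ T) :
    Real.exp (-c * r) ≤ Real.exp (|c| * T) := by
  apply Real.exp_le_exp.2
  calc -c * r ≤ |c| * r := mul_le_mul_of_nonneg_right (neg_le_abs c) h0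
    _ ≤ |c| * T := mul_le_mul_of_nonneg_left hr (abs_nonneg c)

theorem measurable_sourceTerm (hf : Measurable f) : Measurable (sourceTerm G c f) := by
  have h : Measurable fun y : (G.Torus × ℝ × ℝ) × ℝ =>
      Real.exp (-c * y.2) * f (y.1 + flow G y.2) :=
    ((measurable_const.mul measurable_snd).exp).mul
      (hf.comp (measurable_fst.add ((continuous_flow G).measurable.comp measurable_snd)))
  exact (h.stronglyMeasurable.integral_prod_right (ν := volume.restrict (Ioc 0 G.T))).measurable

theorem measurable_finalTerm (h : Measurable σT) : Measurable (finalTerm G c σT) := by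
  refine Measurable.mul (by fun_prop) (h.comp (Measurable.prodMk ?_ (by fun_prop)))
  exact measurable_fst.add (measurable_torus_coe (by fun_prop))

theorem measurable_duhamel (h : Measurable σT) (hf : Measurable f) :
    Measurable (duhamel G c σT f) :=
  (measurable_finalTerm h).add (measurable_sourceTerm hf)

instance : (volume : Measure (G.Torus × ℝ × ℝ)).IsAddRightInvariant := by
  have : (volume : Measure (ℝ × ℝ)).IsAddRightInvariant := by
    rw [Measure.volume_eq_prod]; infer_instance
  rw [Measure.volume_eq_prod]
  infer_instance

theorem measurePreserving_add_flow (μ : Measure ℝ) [SFinite μ] :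
    MeasurePreserving (fun y : (G.Torus × ℝ × ℝ) × ℝ => (y.1 + flow G y.2, y.2))
      (volume.prod μ) (volume.prod μ) :=
  measurePreserving_shear _ _ (continuous_flow G).measurable

theorem enorm_sourceTerm_le (q : G.Torus × ℝ × ℝ) :
    ‖sourceTerm G c f q‖ₑ ≤ ENNReal.ofReal (Real.exp (|c| * G.T)) *
      ∫⁻ r in Ioc (0 : ℝ) G.T, ‖f (q + flow G r)‖ₑ := by
  refine (enorm_integral_le_lintegral_enorm _).trans ?_
  rw [← lintegral_const_mul' _ _ ENNReal.ofReal_ne_top]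
  refine setLIntegral_mono' measurableSet_Ioc fun r hr => ?_
  rw [enorm_mul]
  gcongr
  rw [Real.enorm_of_nonneg (Real.exp_pos _).le]
  exact ENNReal.ofReal_le_ofReal (exp_neg_mul_le hr.1.le hr.2)

/-- Cauchy-Schwarz in `r`, followed by invariance of the product measure under the shear `(q, r) ↦
(q + flow G r, r)`. -/
theorem memLp_sourceTerm (hf : Measurable f) (h2 : MemLp f 2 volume) :
    MemLp (sourceTerm G c f) 2 volume := by
  rw [memLp_two_iff_lintegral (measurable_sourceTerm hf).aestronglyMeasurable]
  have hF : MemLp (fun y : (G.Torus × ℝ × ℝ) × ℝ => f (y.1 + flow G y.2)) 2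
      (volume.prod (volume.restrict (Ioc 0 G.T))) :=
    (h2.comp_fst (volume.restrict (Ioc 0 G.T))).comp_measurePreserving
      (measurePreserving_add_flow (volume.restrict (Ioc 0 G.T)))
  have hFm : Measurable fun y : (G.Torus × ℝ × ℝ) × ℝ => f (y.1 + flow G y.2) :=
    hf.comp (measurable_fst.add ((continuous_flow G).measurable.comp measurable_snd))
  have hlt := (memLp_two_iff_lintegral hF.1).1 hF
  rw [lintegral_prod _ (hFm.enorm.pow_const 2).aemeasurable] at hlt
  set M := ENNReal.ofReal (Real.exp (|c| * G.T))
  have hM : M ≠ ⊤ := ENNReal.ofReal_ne_top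
  calc ∫⁻ q, ‖sourceTerm G c f q‖ₑ ^ 2
      ≤ ∫⁻ q, M ^ 2 * ((volume.restrict (Ioc 0 G.T)) univ *
          ∫⁻ r in Ioc (0 : ℝ) G.T, ‖f (q + flow G r)‖ₑ ^ 2) := by
        refine lintegral_mono fun q => ?_
        refine (pow_le_pow_left' (enorm_sourceTerm_le q) 2).trans ?_
        rw [mul_pow]
        gcongr
        exact sq_lintegral_le (hFm.comp measurable_prodMk_left).enorm.aemeasurable
    _ < ⊤ := by
        rw [lintegral_const_mul' _ _ (ENNReal.pow_ne_top hM),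
          lintegral_const_mul' _ _ (measure_ne_top _ _)]
        exact ENNReal.mul_lt_top (ENNReal.pow_lt_top hM.lt_top)
          (ENNReal.mul_lt_top (measure_lt_top _ _) hlt)

theorem integrable_flow_prod (hi : Integrable f) (μ : Measure ℝ) [IsFiniteMeasure μ] :
    Integrable (fun y : (G.Torus × ℝ × ℝ) × ℝ => f (y.1 + flow G y.2)) (volume.prod μ) :=
  (measurePreserving_add_flow μ).integrable_comp_of_integrable (hi.comp_fst μ)

theorem IsTest.integral_eq_integral_Q {ψ g : G.Torus × ℝ × ℝ → ℝ} (hψ : IsTest G G.Q ψ) :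
    ∫ q in G.Q, g q * ψ q = ∫ q, g q * ψ q :=
  setIntegral_eq_integral_of_forall_compl_eq_zero fun q hq => by
    have : ψ q = 0 := by
      by_contra h
      exact hq (hψ.support_subset (subset_tsupport _ h))
    simp [this]

/-- Fubini, then for each `r` the translation by `flow G r`. Translations do not preserve `Q`, so
both integrals are first extended to the whole space, where `ψ` and `f` vanish off `Q`. -/
theorem integral_sourceTerm_mul {ψ : G.Torus × ℝ × ℝ → ℝ} (hψ : IsTest G G.Q ψ)
    (hi : Integrable f) (h0 : ∀ q, q ∉ G.Q → f q = 0) :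
    ∫ q in G.Q, sourceTerm G c f q * ψ q = ∫ q in G.Q, f q * dual G c ψ q := by
  obtain ⟨B, hB⟩ := hψ.exists_bound
  set μ := (volume : Measure ℝ).restrict (Ioc 0 G.T) with hμ
  have hI : Integrable (fun y : (G.Torus × ℝ × ℝ) × ℝ =>
      f (y.1 + flow G y.2) * (Real.exp (-c * y.2) * ψ y.1)) (volume.prod μ) := by
    refine (integrable_flow_prod hi μ).mul_bdd (c := Real.exp (|c| * G.T) * B) ?_ ?_
    · exact (((measurable_const.mul measurable_snd).exp).mul
        (hψ.measurable.comp measurable_fst)).aestronglyMeasurable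
    · have h1 : ∀ᵐ r ∂μ, r ∈ Ioc 0 G.T := ae_restrict_mem measurableSet_Ioc
      filter_upwards [Measure.quasiMeasurePreserving_snd.ae h1] with y hy
      rw [norm_mul, Real.norm_of_nonneg (Real.exp_pos _).le]
      exact mul_le_mul (exp_neg_mul_le hy.1.le hy.2) (hB _) (norm_nonneg _) (Real.exp_pos _).le
  have hE1 : ∀ q, sourceTerm G c f q * ψ q =
      ∫ r, f (q + flow G r) * (Real.exp (-c * r) * ψ q) ∂μ := by
    intro q
    rw [sourceTerm, ← integral_mul_const]
    exact integral_congr_ae (Filter.Eventually.of_forall fun r => by ring)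
  have hE2 : ∀ q, f q * dual G c ψ q =
      ∫ r, f q * (Real.exp (-c * r) * ψ (q - flow G r)) ∂μ := by
    intro q
    rw [dual, intervalIntegral.integral_of_le G.T_pos.le, integral_const_mul]
  have hI2 : Integrable (fun y : (G.Torus × ℝ × ℝ) × ℝ =>
      f y.1 * (Real.exp (-c * y.2) * ψ (y.1 - flow G y.2))) (volume.prod μ) := by
    rw [← (measurePreserving_add_flow (G := G) μ).integrable_comp]
    · simpa [Function.comp_def] using hI
    · refine (hi.comp_fst μ).aestronglyMeasurable.mul (Measurable.aestronglyMeasurable ?_)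
      exact ((measurable_const.mul measurable_snd).exp).mul (hψ.measurable.comp
        (measurable_fst.sub ((continuous_flow G).measurable.comp measurable_snd)))
  rw [hψ.integral_eq_integral_Q, setIntegral_eq_integral_of_forall_compl_eq_zero
    (fun q hq => by rw [h0 q hq, zero_mul])]
  simp only [hE1, hE2]
  rw [integral_integral_swap (f := fun q r => f (q + flow G r) * (Real.exp (-c * r) * ψ q)) hI,
    integral_integral_swap (f := fun q r => f q * (Real.exp (-c * r) * ψ (q - flow G r))) hI2]
  congr 1
  funext r
  rw [← integral_add_right_eq_self (μ := volume)
    (fun q => f q * (Real.exp (-c * r) * ψ (q - flow G r))) (flow G r)]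
  simp

/-- The translation along the characteristics to the final time. -/
theorem measurePreserving_toFinal :
    MeasurePreserving (fun q : G.Torus × ℝ × ℝ =>
      (q.1 + ((G.u * (G.T - q.2.2) : ℝ) : G.Torus), q.2))
      (volume.restrict G.Q) (volume.restrict G.Q) := by
  rw [restrict_Q]
  exact measurePreserving_shear _ _ (φ := fun e : ℝ × ℝ => ((G.u * (G.T - e.2) : ℝ) : G.Torus))
    (measurable_torus_coe (by fun_prop))

theorem measurePreserving_assoc_Q :
    MeasurePreserving (fun q : G.Torus × ℝ × ℝ => ((q.1, q.2.1), q.2.2))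
      (volume.restrict G.Q) ((volume.restrict G.Omega).prod (volume.restrict (Ioo 0 G.T))) := by
  rw [restrict_Q, restrict_Omega, stripMeasure]
  exact (measurePreserving_prodAssoc _ _ _).symm

theorem memLp_finalTerm (hm : Measurable σT) (h : MemLp σT 2 (volume.restrict G.Omega)) :
    MemLp (finalTerm G c σT) 2 (volume.restrict G.Q) := by
  have h1 := (h.comp_fst (volume.restrict (Ioo 0 G.T))).comp_measurePreserving
    measurePreserving_assoc_Q
  have h2 := h1.comp_measurePreserving measurePreserving_toFinal
  refine h2.of_le_mul (c := Real.exp (|c| * G.T)) (measurable_finalTerm hm).aestronglyMeasurable ?_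
  filter_upwards [ae_restrict_mem G.measurableSet_Q] with q hq
  rw [finalTerm, norm_mul, Real.norm_of_nonneg (Real.exp_pos _).le]
  have := hq.2
  exact mul_le_mul_of_nonneg_right (exp_neg_mul_le (by linarith [this.2]) (by linarith [this.1]))
    (norm_nonneg _)

/-- The shear by `u (T - t)` preserves `Q` because it moves only the torus variable. It transfers
the shift from `σT` to `ψ`, and `dual_final` recognises the remaining time integral. -/
theorem integral_finalTerm_mul {ψ : G.Torus × ℝ × ℝ → ℝ} (hψ : IsTest G G.Q ψ)
    (hm : Measurable σT) (h : MemLp σT 2 (volume.restrict G.Omega)) :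
    ∫ q in G.Q, finalTerm G c σT q * ψ q =
      ∫ p in G.Omega, σT p * dual G c ψ (p.1, p.2, G.T) := by
  set k : (G.Torus × ℝ) × ℝ → ℝ := fun y => σT y.1 *
    (Real.exp (-c * (G.T - y.2)) *
      ψ (y.1.1 - ((G.u * (G.T - y.2) : ℝ) : G.Torus), y.1.2, y.2)) with hk
  have hkm : Measurable k := by
    refine (hm.comp measurable_fst).mul (Measurable.mul (by fun_prop) (hψ.measurable.comp ?_))
    refine Measurable.prodMk ?_ (by fun_prop)
    exact (by fun_prop : Measurable fun y : (G.Torus × ℝ) × ℝ => y.1.1).sub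
      (measurable_torus_coe (by fun_prop))
  have hmp := (measurePreserving_assoc_Q (G := G)).comp measurePreserving_toFinal
  have hkc : ∀ q : G.Torus × ℝ × ℝ, finalTerm G c σT q * ψ q =
      k (((q.1 + ((G.u * (G.T - q.2.2) : ℝ) : G.Torus)), q.2.1), q.2.2) := by
    intro q
    simp only [hk, finalTerm, add_sub_cancel_right]
    ring
  have hki : Integrable k ((volume.restrict G.Omega).prod (volume.restrict (Ioo 0 G.T))) := by
    rw [← hmp.integrable_comp hkm.aestronglyMeasurable]
    exact (hψ.integrable_mul (integrable_of_memLp_two (memLp_finalTerm (c := c) hm h))).congr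
      (Filter.Eventually.of_forall hkc)
  calc ∫ q in G.Q, finalTerm G c σT q * ψ q
      = ∫ y, k y ∂((volume.restrict G.Omega).prod (volume.restrict (Ioo 0 G.T))) := by
        rw [← hmp.map_eq, integral_map hmp.measurable.aemeasurable hkm.aestronglyMeasurable]
        exact integral_congr_ae (Filter.Eventually.of_forall hkc)
    _ = ∫ p in G.Omega, σT p * dual G c ψ (p.1, p.2, G.T) := by
        rw [integral_prod _ hki]
        refine integral_congr_ae (Filter.Eventually.of_forall fun p => ?_)
        simp only [hk]
        rw [integral_const_mul, dual_final, intervalIntegral.integral_of_le G.T_pos.le,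
          integral_Ioc_eq_integral_Ioo]

/-- Measurable data for the transport equation, vanishing outside of the cylinder. -/
structure IsData (σT : G.Torus × ℝ → ℝ) (f : G.Torus × ℝ × ℝ → ℝ) : Prop where
  measurable_final : Measurable σT
  memLp_final : MemLp σT 2 (volume.restrict G.Omega)
  measurable_source : Measurable f
  memLp_source : MemLp f 2 volume
  source_eq_zero : ∀ q, q ∉ G.Q → f q = 0

theorem IsData.integrable_source (h : IsData σT f) : Integrable f := by
  have h1 : IntegrableOn f G.Q := integrable_of_memLp_two (h.memLp_source.restrict _)
  rwa [integrableOn_iff_integrable_of_support_subset] at h1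
  intro q hq
  by_contra hn
  exact hq (h.source_eq_zero q hn)

theorem IsData.memLp_duhamel (h : IsData σT f) :
    MemLp (duhamel G c σT f) 2 (volume.restrict G.Q) :=
  (memLp_finalTerm h.measurable_final h.memLp_final).add
    ((memLp_sourceTerm h.measurable_source h.memLp_source).restrict _)

theorem IsData.integral_duhamel_mul (h : IsData σT f) {ψ : G.Torus × ℝ × ℝ → ℝ}
    (hψ : IsTest G G.Q ψ) :
    ∫ q in G.Q, duhamel G c σT f q * ψ q =
      (∫ q in G.Q, f q * dual G c ψ q) + ∫ p in G.Omega, σT p * dual G c ψ (p.1, p.2, G.T) := by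
  have i1 := hψ.integrable_mul (integrable_of_memLp_two
    (memLp_finalTerm (c := c) h.measurable_final h.memLp_final))
  have i2 := hψ.integrable_mul (integrable_of_memLp_two
    ((memLp_sourceTerm (c := c) h.measurable_source h.memLp_source).restrict G.Q))
  simp only [duhamel, add_mul]
  rw [integral_add i1 i2, integral_finalTerm_mul hψ h.measurable_final h.memLp_final,
    integral_sourceTerm_mul hψ h.integrable_source h.source_eq_zero, add_comm]

theorem exists_isData (hσT : MemLp σT 2 (volume.restrict G.Omega))
    (hf : MemLp f 2 (volume.restrict G.Q)) :
    ∃ (σT' : G.Torus × ℝ → ℝ) (f' : G.Torus × ℝ × ℝ → ℝ), IsData σT' f' ∧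
      σT =ᵐ[volume.restrict G.Omega] σT' ∧ f =ᵐ[volume.restrict G.Q] f' := by
  obtain ⟨a, ha, hae⟩ := hσT.1
  obtain ⟨b, hb, hbe⟩ := hf.1
  have hbe' : f =ᵐ[volume.restrict G.Q] G.Q.indicator b :=
    hbe.trans (indicator_ae_eq_restrict G.measurableSet_Q).symm
  refine ⟨a, G.Q.indicator b, ⟨ha.measurable, hσT.ae_eq hae,
    hb.measurable.indicator G.measurableSet_Q,
    (memLp_indicator_iff_restrict G.measurableSet_Q).2 (hf.ae_eq hbe),
    fun q hq => indicator_of_notMem hq b⟩, hae, hbe'⟩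

end Duhamel

/-! ### Weak solutions coincide with Duhamel's formula, also after differentiation. -/

section Representation

variable {G : Channel} {c : ℝ} {σT σT' : G.Torus × ℝ → ℝ} {f f' σ : G.Torus × ℝ × ℝ → ℝ}

/-- The weak formulation is tested with `dual G c ψ`, which turns the adjoint operator into `ψ` on
`Q`. -/
theorem IsSolution.integral_mul (h : IsSolution G c f σT σ) {ψ : G.Torus × ℝ × ℝ → ℝ}
    (hψ : IsTest G G.Q ψ) :
    ∫ q in G.Q, σ q * ψ q =
      (∫ q in G.Q, f q * dual G c ψ q) + ∫ p in G.Omega, σT p * dual G c ψ (p.1, p.2, G.T) := by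
  rw [← h.weak _ (hψ.dual c)]
  refine setIntegral_congr_fun G.measurableSet_Q fun q hq => ?_
  simp only [hψ.dual_eq c hq.2.2.le]

theorem IsSolution.congr_data (h : IsSolution G c f σT σ)
    (hσ : σT =ᵐ[volume.restrict G.Omega] σT') (hf : f =ᵐ[volume.restrict G.Q] f') :
    IsSolution G c f' σT' σ := by
  refine ⟨h.memLp, fun χ hχ => ?_⟩
  rw [h.weak χ hχ]
  congr 1
  · exact integral_congr_ae (hf.mono fun q hq => by simp only [hq])
  · exact integral_congr_ae (hσ.mono fun q hq => by simp only [hq])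

/-- Weak solutions of the transport equation are given by Duhamel's formula. -/
theorem IsSolution.ae_eq_duhamel (h : IsSolution G c f σT σ) (hd : IsData σT f) :
    σ =ᵐ[volume.restrict G.Q] duhamel G c σT f := by
  have hi := integrable_of_memLp_two h.memLp
  have hi' := integrable_of_memLp_two (hd.memLp_duhamel (c := c))
  have := ae_eq_zero_of_forall_isTest (hi.sub hi') fun ψ hψ => by
    simp only [Pi.sub_apply, sub_mul]
    rw [integral_sub (hψ.integrable_mul hi) (hψ.integrable_mul hi'), h.integral_mul hψ,
      hd.integral_duhamel_mul hψ, sub_self]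
  exact this.mono fun q hq => sub_eq_zero.1 hq

/-- Duhamel's formula commutes with weak spatial derivatives. -/
theorem IsSolution.hasWeakDeriv {v : ℝ × ℝ} {gT gT' : G.Torus × ℝ → ℝ}
    {g g' : G.Torus × ℝ × ℝ → ℝ} (h : IsSolution G c f σT σ)
    (hf : MemLp f 2 (volume.restrict G.Q))
    (hg : MemLp g 2 (volume.restrict G.Q))
    (hdT : HasWeakDeriv G G.Omega v σT gT) (hdf : HasWeakDeriv G G.Q (v.1, (v.2, 0)) f g)
    (hd : IsData gT' g') (hgT' : gT =ᵐ[volume.restrict G.Omega] gT')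
    (hg' : g =ᵐ[volume.restrict G.Q] g') :
    HasWeakDeriv G G.Q (v.1, (v.2, 0)) σ (duhamel G c gT' g') := by
  intro ψ hψ
  -- The derivative passes from `ψ` to its dual and then onto the data. `integral_Qpos` is needed
  -- because the dual need not vanish at `t = T`.
  rw [h.integral_mul (hψ.dirDeriv _), hd.integral_duhamel_mul hψ, ← hψ.dirDeriv_dual,
    hdf.integral_Qpos (integrable_of_memLp_two hf) (integrable_of_memLp_two hg) (hψ.dual c)]
  have h1 := hdT _ ((hψ.dual c).atTime G.T)
  rw [dirDeriv_atTime] at h1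
  simp only [atTime] at h1
  rw [h1, neg_add]
  congr 2
  · exact integral_congr_ae (hg'.mono fun q hq => by simp only [hq])
  · exact integral_congr_ae (hgT'.mono fun q hq => by simp only [hq])

end Representation

/-! ### The weighted window estimate on a time interval. -/

section OneDimensional

theorem sq_add_le_two_mul (a b : ℝ≥0∞) : (a + b) ^ 2 ≤ 2 * (a ^ 2 + b ^ 2) := by
  have := ENNReal.rpow_add_le_mul_rpow_add_rpow a b (p := 2) (by norm_num)
  norm_num at this
  exact this

/-- A quantity which is transported with a source is controlled in a weighted norm by its values on
a window `J` if the weight does not decrease on the way to the window. -/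
theorem lintegral_le_of_window {ρ F : ℝ → ℝ} {w : ℝ → ℝ≥0∞} {M : ℝ≥0∞} {T : ℝ} {B J : Set ℝ}
    (hF : Measurable F) (hM : M ≠ ⊤)
    (hBm : MeasurableSet B) (hJm : MeasurableSet J)
    (hB : B ⊆ Ioo 0 T) (hJ : J ⊆ Ioo 0 T)
    (hw : ∀ t ∈ B, ∀ t' ∈ J, ∀ τ ∈ uIcc t t', w t ≤ w τ)
    (hρ : ∀ t ∈ Ioo 0 T, ∀ t' ∈ Ioo 0 T,
      ‖ρ t‖ₑ ≤ M * (‖ρ t'‖ₑ + ∫⁻ τ in uIoc t t', ‖F τ‖ₑ)) :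
    volume J * ∫⁻ t in B, w t ^ 2 * ‖ρ t‖ₑ ^ 2 ≤
      2 * M ^ 2 * ((∫⁻ t in J, w t ^ 2 * ‖ρ t‖ₑ ^ 2) +
        volume J * (ENNReal.ofReal T * ∫⁻ t in Ioo 0 T, w t ^ 2 * ‖F t‖ₑ ^ 2)) *
        ENNReal.ofReal T := by
  set I := ENNReal.ofReal T * ∫⁻ t in Ioo 0 T, w t ^ 2 * ‖F t‖ₑ ^ 2 with hI
  have hM2 : 2 * M ^ 2 ≠ ⊤ := ENNReal.mul_ne_top (by norm_num) (ENNReal.pow_ne_top hM)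
  have hvJ : volume J ≠ ⊤ :=
    ne_top_of_le_ne_top (by simp [Real.volume_Ioo]) (measure_mono hJ)
  -- The weight at `t` is moved inside the integral and onto `t'` by monotonicity, at the cost of
  -- Cauchy-Schwarz only.
  have hpt : ∀ t ∈ B, ∀ t' ∈ J,
      w t ^ 2 * ‖ρ t‖ₑ ^ 2 ≤ 2 * M ^ 2 * (w t' ^ 2 * ‖ρ t'‖ₑ ^ 2 + I) := by
    intro t ht t' ht'
    have hsub : uIoc t t' ⊆ Ioo 0 T := uIoc_subset_uIcc.trans
      ((ordConnected_Ioo).uIcc_subset (hB ht) (hJ ht'))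
    have h1 : (∫⁻ τ in uIoc t t', ‖F τ‖ₑ) ^ 2 ≤
        ENNReal.ofReal T * ∫⁻ τ in uIoc t t', ‖F τ‖ₑ ^ 2 := by
      refine (sq_lintegral_le hF.enorm.aemeasurable).trans ?_
      gcongr
      rw [Measure.restrict_apply_univ]
      exact (measure_mono hsub).trans (by simp [Real.volume_Ioo])
    have h2 : w t ^ 2 * (∫⁻ τ in uIoc t t', ‖F τ‖ₑ) ^ 2 ≤ I := by
      calc w t ^ 2 * (∫⁻ τ in uIoc t t', ‖F τ‖ₑ) ^ 2
          ≤ w t ^ 2 * (ENNReal.ofReal T * ∫⁻ τ in uIoc t t', ‖F τ‖ₑ ^ 2) := by gcongr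
        _ = ENNReal.ofReal T * ∫⁻ τ in uIoc t t', w t ^ 2 * ‖F τ‖ₑ ^ 2 := by
          rw [lintegral_const_mul _ (hF.enorm.pow_const 2)]; ring
        _ ≤ ENNReal.ofReal T * ∫⁻ τ in uIoc t t', w τ ^ 2 * ‖F τ‖ₑ ^ 2 := by
          refine mul_le_mul_right (setLIntegral_mono' measurableSet_uIoc fun τ hτ => ?_) _
          have := hw t ht t' ht' τ (uIoc_subset_uIcc hτ)
          gcongr
        _ ≤ I := by
          refine mul_le_mul_right (lintegral_mono_set hsub) _
    calc w t ^ 2 * ‖ρ t‖ₑ ^ 2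
        ≤ w t ^ 2 * (M * (‖ρ t'‖ₑ + ∫⁻ τ in uIoc t t', ‖F τ‖ₑ)) ^ 2 := by
          have := hρ t (hB ht) t' (hJ ht')
          gcongr
      _ = w t ^ 2 * M ^ 2 * (‖ρ t'‖ₑ + ∫⁻ τ in uIoc t t', ‖F τ‖ₑ) ^ 2 := by ring
      _ ≤ w t ^ 2 * M ^ 2 * (2 * (‖ρ t'‖ₑ ^ 2 + (∫⁻ τ in uIoc t t', ‖F τ‖ₑ) ^ 2)) := by
          gcongr
          exact sq_add_le_two_mul _ _
      _ = 2 * M ^ 2 * (w t ^ 2 * ‖ρ t'‖ₑ ^ 2 +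
            w t ^ 2 * (∫⁻ τ in uIoc t t', ‖F τ‖ₑ) ^ 2) := by ring
      _ ≤ 2 * M ^ 2 * (w t' ^ 2 * ‖ρ t'‖ₑ ^ 2 + I) := by
          have := hw t ht t' ht' t' right_mem_uIcc
          gcongr
  -- Integration over `t' ∈ J` replaces the pointwise value in the window by an integral.
  have hav : ∀ t ∈ B, volume J * (w t ^ 2 * ‖ρ t‖ₑ ^ 2) ≤
      2 * M ^ 2 * ((∫⁻ t in J, w t ^ 2 * ‖ρ t‖ₑ ^ 2) + volume J * I) := by
    intro t ht
    calc volume J * (w t ^ 2 * ‖ρ t‖ₑ ^ 2)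
        = ∫⁻ _ in J, w t ^ 2 * ‖ρ t‖ₑ ^ 2 := by rw [setLIntegral_const, mul_comm]
      _ ≤ ∫⁻ t' in J, 2 * M ^ 2 * (w t' ^ 2 * ‖ρ t'‖ₑ ^ 2 + I) :=
          setLIntegral_mono' hJm fun t' ht' => hpt t ht t' ht'
      _ = 2 * M ^ 2 * ((∫⁻ t in J, w t ^ 2 * ‖ρ t‖ₑ ^ 2) + volume J * I) := by
          rw [lintegral_const_mul' _ _ hM2, lintegral_add_right _ measurable_const,
            setLIntegral_const, mul_comm I]
  calc volume J * ∫⁻ t in B, w t ^ 2 * ‖ρ t‖ₑ ^ 2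
      = ∫⁻ t in B, volume J * (w t ^ 2 * ‖ρ t‖ₑ ^ 2) := by rw [lintegral_const_mul' _ _ hvJ]
    _ ≤ ∫⁻ _ in B, 2 * M ^ 2 * ((∫⁻ t in J, w t ^ 2 * ‖ρ t‖ₑ ^ 2) + volume J * I) :=
        setLIntegral_mono' hBm hav
    _ ≤ _ := by
        rw [setLIntegral_const]
        gcongr
        exact (measure_mono hB).trans (by simp [Real.volume_Ioo])

end OneDimensional

/-! ### Solutions along characteristics. -/

section Characteristics

variable (G : Channel)

/-- The point at time `t` of the characteristic through `(p, 0)`. -/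
def charPoint (p : G.Torus × ℝ) (t : ℝ) : G.Torus × ℝ × ℝ :=
  (p.1 + ((G.u * t : ℝ) : G.Torus), p.2, t)

variable {G} {c : ℝ} {σT : G.Torus × ℝ → ℝ} {f : G.Torus × ℝ × ℝ → ℝ}

theorem measurable_charPoint :
    Measurable fun y : (G.Torus × ℝ) × ℝ => charPoint G y.1 y.2 :=
  Measurable.prodMk ((by fun_prop : Measurable fun y : (G.Torus × ℝ) × ℝ => y.1.1).add
    (measurable_torus_coe (by fun_prop))) (by fun_prop)

theorem measurePreserving_charPoint :
    MeasurePreserving (fun y : (G.Torus × ℝ) × ℝ => charPoint G y.1 y.2)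
      ((volume.restrict G.Omega).prod (volume.restrict (Ioo 0 G.T))) (volume.restrict G.Q) := by
  have h1 : MeasurePreserving (fun q : G.Torus × ℝ × ℝ =>
      (q.1 + ((G.u * q.2.2 : ℝ) : G.Torus), q.2))
      (volume.restrict G.Q) (volume.restrict G.Q) := by
    rw [restrict_Q]
    exact measurePreserving_shear _ _ (φ := fun e : ℝ × ℝ => ((G.u * e.2 : ℝ) : G.Torus))
      (measurable_torus_coe (by fun_prop))
  have h2 : MeasurePreserving (fun y : (G.Torus × ℝ) × ℝ => (y.1.1, y.1.2, y.2))
      ((volume.restrict G.Omega).prod (volume.restrict (Ioo 0 G.T))) (volume.restrict G.Q) := by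
    rw [restrict_Q, restrict_Omega, stripMeasure]
    exact measurePreserving_prodAssoc _ _ _
  exact h1.comp h2

theorem charPoint_add_flow (p : G.Torus × ℝ) (t r : ℝ) :
    charPoint G p t + flow G r = charPoint G p (t + r) := by
  simp [charPoint, flow, mul_add, add_assoc]

/-- Duhamel's formula along a characteristic. -/
theorem duhamel_charPoint {p : G.Torus × ℝ} (h0 : ∀ q, q ∉ G.Q → f q = 0)
    (hF : Integrable fun τ => f (charPoint G p τ)) {t : ℝ} (ht : t ∈ Ioo 0 G.T) :
    duhamel G c σT f (charPoint G p t) = Real.exp (c * t) *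
      (Real.exp (-c * G.T) * σT (p.1 + ((G.u * G.T : ℝ) : G.Torus), p.2) +
        ∫ τ in t..G.T, Real.exp (-c * τ) * f (charPoint G p τ)) := by
  have hI : ∀ a b : ℝ, IntervalIntegrable
      (fun τ => Real.exp (-c * τ) * f (charPoint G p τ)) volume a b := fun a b =>
    hF.intervalIntegrable.continuousOn_mul (by fun_prop)
  have h1 : sourceTerm G c f (charPoint G p t) =
      Real.exp (c * t) * ∫ τ in t..G.T, Real.exp (-c * τ) * f (charPoint G p τ) := by
    -- `sourceTerm` always integrates over a time span of length `T`; the part beyond the final time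
    -- vanishes since `f` is zero off `Q`.
    have h2 : ∫ τ in G.T..t + G.T, Real.exp (-c * τ) * f (charPoint G p τ) = 0 := by
      rw [intervalIntegral.integral_congr (g := fun _ => 0)]
      · simp
      · intro τ hτ
        rw [uIcc_of_le (by linarith [ht.1])] at hτ
        simp only
        rw [h0 _ (fun hq => absurd hq.2.2 (not_lt.2 hτ.1)), mul_zero]
    have h3 := intervalIntegral.integral_comp_add_left (a := 0) (b := G.T)
      (fun τ => Real.exp (c * t) * (Real.exp (-c * τ) * f (charPoint G p τ))) t
    rw [add_zero, intervalIntegral.integral_const_mul (a := t),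
      ← intervalIntegral.integral_add_adjacent_intervals (hI t G.T) (hI G.T _), h2, add_zero] at h3
    rw [← h3, sourceTerm, intervalIntegral.integral_of_le G.T_pos.le]
    refine integral_congr_ae (Filter.Eventually.of_forall fun r => ?_)
    simp only
    rw [charPoint_add_flow, ← mul_assoc, ← Real.exp_add]
    ring_nf
  have h2 : finalTerm G c σT (charPoint G p t) = Real.exp (c * t) *
      (Real.exp (-c * G.T) * σT (p.1 + ((G.u * G.T : ℝ) : G.Torus), p.2)) := by
    rw [finalTerm, ← mul_assoc, ← Real.exp_add]
    simp only [charPoint]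
    rw [add_assoc, ← AddCircle.coe_add]
    ring_nf
  rw [duhamel, h1, h2, mul_add]

/-- Variation of constants between two times in either order; the window may precede or follow the
unobserved interval. The factor bounds `e^{c(t-τ)}` for `|t - τ| ≤ T`. -/
theorem enorm_duhamel_charPoint_le {p : G.Torus × ℝ} (h0 : ∀ q, q ∉ G.Q → f q = 0)
    (hF : Integrable fun τ => f (charPoint G p τ)) {t t' : ℝ} (ht : t ∈ Ioo 0 G.T)
    (ht' : t' ∈ Ioo 0 G.T) :
    ‖duhamel G c σT f (charPoint G p t)‖ₑ ≤ ENNReal.ofReal (Real.exp (|c| * G.T)) *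
      (‖duhamel G c σT f (charPoint G p t')‖ₑ +
        ∫⁻ τ in uIoc t t', ‖f (charPoint G p τ)‖ₑ) := by
  have hI : ∀ a b : ℝ, IntervalIntegrable
      (fun τ => Real.exp (-c * τ) * f (charPoint G p τ)) volume a b := fun a b =>
    hF.intervalIntegrable.continuousOn_mul (by fun_prop)
  have hexp : ∀ τ ∈ Ioo 0 G.T,
      ‖Real.exp (c * (t - τ))‖ₑ ≤ ENNReal.ofReal (Real.exp (|c| * G.T)) := by
    intro τ hτ
    rw [Real.enorm_of_nonneg (Real.exp_pos _).le]
    refine ENNReal.ofReal_le_ofReal (Real.exp_le_exp.2 ((le_abs_self _).trans ?_))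
    rw [abs_mul]
    refine mul_le_mul_of_nonneg_left (abs_le.2 ⟨?_, ?_⟩) (abs_nonneg c)
    · linarith [ht.1, hτ.2]
    · linarith [ht.2, hτ.1]
  have key : duhamel G c σT f (charPoint G p t) =
      Real.exp (c * (t - t')) * duhamel G c σT f (charPoint G p t') +
        ∫ τ in t..t', Real.exp (c * (t - τ)) * f (charPoint G p τ) := by
    have h1 : ∫ τ in t..t', Real.exp (c * (t - τ)) * f (charPoint G p τ) =
        Real.exp (c * t) * ∫ τ in t..t', Real.exp (-c * τ) * f (charPoint G p τ) := by
      rw [← intervalIntegral.integral_const_mul]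
      congr 1
      funext τ
      rw [← mul_assoc, ← Real.exp_add]
      ring_nf
    rw [h1, duhamel_charPoint h0 hF ht, duhamel_charPoint h0 hF ht', ← mul_assoc,
      ← Real.exp_add, ← intervalIntegral.integral_add_adjacent_intervals (hI t t') (hI t' G.T)]
    ring_nf
  rw [key, mul_add]
  refine (enorm_add_le _ _).trans (add_le_add ?_ ?_)
  · rw [enorm_mul]
    gcongr
    exact hexp t' ht'
  · rw [← lintegral_const_mul' _ _ ENNReal.ofReal_ne_top,
      ← enorm_norm, intervalIntegral.norm_integral_eq_norm_integral_uIoc, enorm_norm]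
    refine (enorm_integral_le_lintegral_enorm _).trans
      (setLIntegral_mono' measurableSet_uIoc fun τ hτ => ?_)
    rw [enorm_mul]
    gcongr
    exact hexp τ ((ordConnected_Ioo).uIcc_subset ht ht' (uIoc_subset_uIcc hτ))

theorem IsData.ae_integrable_charPoint (h : IsData σT f) :
    ∀ᵐ p ∂volume.restrict G.Omega, Integrable fun τ => f (charPoint G p τ) := by
  have h1 := (measurePreserving_charPoint (G := G)).integrable_comp_of_integrable
    (h.integrable_source.integrableOn (s := G.Q))
  filter_upwards [h1.prod_right_ae] with p hp
  refine (integrableOn_iff_integrable_of_support_subset (s := Ioo 0 G.T) ?_).1 hp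
  intro τ hτ
  by_contra hn
  exact hτ (h.source_eq_zero _ fun hq => hn hq.2)

end Characteristics

/-! ### Monotonicity of the weights and choice of the window. -/

namespace WeightData

variable {G : Channel} (W : WeightData G)

/-- Half of the length of time which is neither needed to cross the channel nor close to the
endpoints of the time interval. -/
def window : ℝ := ((G.T - G.d / G.u) - (2 * W.T0 + 2 * W.T1)) / 2

theorem window_pos : 0 < W.window := half_pos (sub_pos.2 W.T0_T1_small)

theorem two_T0_lt : 2 * W.T0 < G.T - 2 * W.T1 := by
  have := W.T0_T1_small
  have := div_pos G.d_pos G.u_pos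
  linarith

/-- This range and that of `monotoneOn_θ` overlap on the plateau `[2T₀, T - 2T₁]`, which leaves a
choice of direction in `exists_window`. -/
theorem antitoneOn_θ : AntitoneOn W.θ (Ioc 0 (G.T - 2 * W.T1)) := by
  have h0 := W.T0_pos
  have h2 := W.two_T0_lt
  have a1 : AntitoneOn W.θ (Ioc 0 W.T0) := by
    intro s hs t ht hst
    rw [W.θ_left s hs, W.θ_left t ht]
    have := hs.1
    gcongr
  have a3 : AntitoneOn W.θ (Icc (2 * W.T0) (G.T - 2 * W.T1)) := by
    intro s hs t ht _
    rw [W.θ_mid s hs, W.θ_mid t ht]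
  have a2 := a1.union_right W.θ_anti.antitoneOn
    (isGreatest_Ioc h0) (isLeast_Icc (by linarith))
  rw [Ioc_union_Icc_eq_Ioc h0 (by linarith)] at a2
  have := a2.union_right a3 (isGreatest_Ioc (by linarith)) (isLeast_Icc h2.le)
  rwa [Ioc_union_Icc_eq_Ioc (by linarith) h2.le] at this

theorem monotoneOn_θ : MonotoneOn W.θ (Ico (2 * W.T0) G.T) := by
  have h1 := W.T1_pos
  have h2 := W.two_T0_lt
  have a3 : MonotoneOn W.θ (Ico (G.T - W.T1) G.T) := by
    intro s hs t ht hst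
    rw [W.θ_right s hs, W.θ_right t ht]
    have : 0 < G.T - t := by linarith [ht.2]
    gcongr
  have a1 : MonotoneOn W.θ (Icc (2 * W.T0) (G.T - 2 * W.T1)) := by
    intro s hs t ht _
    rw [W.θ_mid s hs, W.θ_mid t ht]
  have a2 := a1.union_right W.θ_mono.monotoneOn
    (isGreatest_Icc h2.le) (isLeast_Icc (by linarith))
  rw [Icc_union_Icc_eq_Icc h2.le (by linarith)] at a2
  have := a2.union_right a3 (isGreatest_Icc (by linarith)) (isLeast_Ico (by linarith))
  rwa [Icc_union_Ico_eq_Ico (by linarith) (by linarith)] at this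

theorem θ_pos {t : ℝ} (ht : t ∈ Ioo 0 G.T) : 0 < W.θ t := by
  have h0 := W.T0_pos
  have h1 := W.T1_pos
  have h2 := W.two_T0_lt
  rcases le_total t (G.T - 2 * W.T1) with h | h
  · refine lt_of_lt_of_le zero_lt_one ?_ |>.trans_le
      (W.antitoneOn_θ ⟨ht.1, h⟩ (right_mem_Ioc.2 (by linarith)) h)
    rw [W.θ_mid _ (right_mem_Icc.2 h2.le)]
  · refine lt_of_lt_of_le zero_lt_one ?_ |>.trans_le
      (W.monotoneOn_θ (left_mem_Ico.2 (by linarith)) ⟨by linarith, ht.2⟩ (h2.le.trans h))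
    rw [W.θ_mid _ (left_mem_Icc.2 h2.le)]

/-- A time interval of length `d / u` can be left in one direction of time, along which `θ` does
not increase. -/
theorem exists_window (a : ℝ) :
    (∀ t ∈ Ioo 0 G.T, t ∉ Icc a (a + G.d / G.u)) ∨
    ∃ j, Ioo j (j + W.window) ⊆ Ioo 0 G.T ∧
      (∀ t ∈ Ioo j (j + W.window), t ∉ Icc a (a + G.d / G.u)) ∧
      ∀ t ∈ Icc a (a + G.d / G.u) ∩ Ioo 0 G.T, ∀ t' ∈ Ioo j (j + W.window),
        ∀ τ ∈ uIcc t t', W.θ τ ≤ W.θ t := by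
  have h0 := W.T0_pos
  have h1 := W.T1_pos
  have hℓ := W.window_pos
  have hdef : 2 * W.window = (G.T - G.d / G.u) - (2 * W.T0 + 2 * W.T1) := by
    unfold window; ring
  set ℓ := W.window
  have hd := div_pos G.d_pos G.u_pos
  set D := G.d / G.u
  -- If `a ≥ 2T₀ + ℓ`, a window of length `ℓ` just before `a` stays where `θ` is nondecreasing.
  -- Otherwise `a + d/u + ℓ ≤ 2T₀ + 2ℓ + d/u = T - 2T₁`, and the window just after the interval ends
  -- where `θ` is still nonincreasing. This is why `ℓ` is half of the spare time.
  rcases le_total (2 * W.T0 + ℓ) a with h | h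
  · rcases le_or_gt G.T a with hT | hT
    · left
      intro t ht ht'
      linarith [ht.2, ht'.1]
    · right
      refine ⟨a - ℓ, ?_, ?_, ?_⟩
      · intro t ht
        exact ⟨by linarith [ht.1], by linarith [ht.2]⟩
      · intro t ht ht'
        linarith [ht.2, ht'.1]
      · intro t ht t' ht' τ hτ
        have ht'2 : t' < a := by linarith [ht'.2]
        have h3 : t' ≤ t := by linarith [ht.1.1]
        rw [uIcc_of_ge h3] at hτ
        exact W.monotoneOn_θ ⟨by linarith [hτ.1, ht'.1], lt_of_le_of_lt hτ.2 ht.2.2⟩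
          ⟨by linarith [ht.1.1], ht.2.2⟩ hτ.2
  · rcases le_or_gt (a + D) 0 with hT | hT
    · left
      intro t ht ht'
      linarith [ht.1, ht'.2]
    · right
      refine ⟨a + D, ?_, ?_, ?_⟩
      · intro t ht
        exact ⟨by linarith [ht.1], by linarith [ht.2]⟩
      · intro t ht ht'
        linarith [ht.1, ht'.2]
      · intro t ht t' ht' τ hτ
        have h3 : t ≤ t' := by linarith [ht.1.2, ht'.1]
        rw [uIcc_of_le h3] at hτ
        exact W.antitoneOn_θ ⟨ht.2.1, by linarith [ht.1.2]⟩
          ⟨lt_of_lt_of_le ht.2.1 hτ.1, by linarith [hτ.2, ht'.2]⟩ hτ.1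

theorem continuous_η : Continuous W.η :=
  (QuotientAddGroup.isOpenQuotientMap_mk
    (N := AddSubgroup.zmultiples G.period)).continuous_comp_iff.1 W.η_smooth.continuous

theorem η_le_supη0 (x : G.Torus) : W.η x ≤ W.supη0 := by
  obtain ⟨B, hB⟩ := isCompact_univ.exists_bound_of_continuousOn W.continuous_η.continuousOn
  have hb : BddAbove (range fun p : G.Torus × Icc (0 : ℝ) G.T => |W.η0 p.1 p.2|) :=
    ⟨B, by rintro _ ⟨p, rfl⟩; exact hB _ (mem_univ _)⟩
  have := le_ciSup hb (x, ⟨0, left_mem_Icc.2 G.T_pos.le⟩)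
  refine le_trans ?_ this
  simp only [η0, mul_zero, AddCircle.coe_zero, sub_zero]
  exact le_abs_self _

/-- The weight `ξ^{-1/2} e^{-sφ}`. -/
def weight (s lam : ℝ) (q : G.Torus × ℝ × ℝ) : ℝ :=
  W.xi lam q.1 q.2.2 ^ (-(1 / 2) : ℝ) * Real.exp (-s * W.phi lam q.1 q.2.2)

/-- Along characteristics the weight is a decreasing function of `θ`. -/
theorem weight_charPoint_le {s lam : ℝ} (hs : 1 ≤ s) (hl : 1 ≤ lam) (p : G.Torus × ℝ) {t τ : ℝ}
    (hτ : 0 < W.θ τ) (hle : W.θ τ ≤ W.θ t) :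
    ‖W.weight s lam (charPoint G p t)‖ₑ ≤ ‖W.weight s lam (charPoint G p τ)‖ₑ := by
  have hη : ∀ t, W.η0 (charPoint G p t).1 (charPoint G p t).2.2 = W.η p.1 := fun t => by
    simp [η0, charPoint]
  have hE : 0 < Real.exp (lam * (W.η p.1 + 4 * W.supη0)) := Real.exp_pos _
  -- Since `0 < η ≤ ‖η⁰‖`, one has `η + 4‖η⁰‖ ≤ 6‖η⁰‖`. Thus `φ` is a nonnegative multiple of `θ`,
  -- and both factors of the weight decrease with `θ`.
  have hK : Real.exp (lam * (W.η p.1 + 4 * W.supη0)) ≤ Real.exp (6 * lam * W.supη0) := by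
    apply Real.exp_le_exp.2
    have h1 := W.η_le_supη0 p.1
    have h2 := W.η_pos p.1
    nlinarith
  have hpos : ∀ t, 0 < W.θ t → 0 ≤ W.weight s lam (charPoint G p t) := by
    intro t ht
    unfold weight xi
    positivity
  rw [Real.enorm_of_nonneg (hpos t (hτ.trans_le hle)), Real.enorm_of_nonneg (hpos τ hτ)]
  refine ENNReal.ofReal_le_ofReal ?_
  simp only [weight, xi, phi, hη]
  simp only [charPoint]
  refine mul_le_mul ?_ ?_ (Real.exp_pos _).le ?_
  · refine Real.rpow_le_rpow_of_nonpos (by positivity) ?_ (by norm_num)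
    gcongr
  · apply Real.exp_le_exp.2
    have := mul_le_mul_of_nonneg_right hle (sub_nonneg.2 hK)
    nlinarith
  · positivity

/-- Only almost everywhere on `Q`: nothing is known about `θ` outside `(0,T)`. -/
theorem aemeasurable_weight (s lam : ℝ) :
    AEMeasurable (W.weight s lam) (volume.restrict G.Q) := by
  have h1 : AEMeasurable W.θ (volume.restrict (Ioo 0 G.T)) :=
    (W.θ_smooth.continuousOn.aemeasurable measurableSet_Ioo)
  have h2 : AEMeasurable (fun q : G.Torus × ℝ × ℝ => W.θ q.2.2) (volume.restrict G.Q) := by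
    rw [restrict_Q]
    exact h1.comp_quasiMeasurePreserving
      (Measure.quasiMeasurePreserving_snd.comp Measure.quasiMeasurePreserving_snd)
  have h3 : Measurable fun q : G.Torus × ℝ × ℝ => W.η0 q.1 q.2.2 :=
    W.continuous_η.measurable.comp (measurable_fst.sub (measurable_torus_coe (by fun_prop)))
  have h4 := h3.aemeasurable (μ := volume.restrict G.Q)
  have h5 : AEMeasurable (fun q : G.Torus × ℝ × ℝ =>
      Real.exp (lam * (W.η0 q.1 q.2.2 + 4 * W.supη0))) (volume.restrict G.Q) :=
    ((h4.add_const _).const_mul lam).exp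
  exact ((h2.mul h5).pow_const _).mul ((h2.mul (h5.const_sub _)).const_mul (-s)).exp

end WeightData

/-! ### Geometry of the observation region. -/

section Observation

variable {G : Channel}

theorem Channel.measurableSet_omegaT : MeasurableSet G.omegaT := by
  have h1 : MeasurableSet ((fun x : ℝ => (x : G.Torus)) ''
      (Ioo (-G.L) 0 ∪ Ioc G.d (G.d + G.L))) := by
    have ho : IsOpenMap (fun x : ℝ => (x : G.Torus)) :=
      (QuotientAddGroup.isOpenQuotientMap_mk (N := AddSubgroup.zmultiples G.period)).isOpenMap
    have hL : 0 < G.L := by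
      have := mul_pos G.u_pos G.T_pos
      unfold Channel.L; nlinarith
    rw [← Ioo_insert_right (by linarith : G.d < G.d + G.L), union_insert, image_insert_eq]
    exact (ho _ (isOpen_Ioo.union isOpen_Ioo)).measurableSet.insert _
  exact (h1.preimage measurable_fst).inter
    ((measurableSet_Ioo.preimage (measurable_fst.comp measurable_snd)).inter
      (measurableSet_Ioo.preimage (measurable_snd.comp measurable_snd)))

theorem Channel.omegaT_subset_Q : G.omegaT ⊆ G.Q := fun _ hq => hq.2

/-- A characteristic stays in the unobserved region during a time interval of length at most
`d / u`. -/
theorem exists_charPoint_mem_omegaT (p : G.Torus × ℝ) (hp : p ∈ G.Omega) :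
    ∃ a : ℝ, ∀ t ∈ Ioo 0 G.T, t ∉ Icc a (a + G.d / G.u) → charPoint G p t ∈ G.omegaT := by
  obtain ⟨x, z⟩ := p
  have hu := G.u_pos
  have hP : G.period = G.d + 2 * G.L := rfl
  have hL : G.L = 3 * G.u * G.T := rfl
  obtain ⟨r, hr, rfl⟩ : ∃ r ∈ Ico (-G.L) (-G.L + G.period), (r : G.Torus) = x :=
    ⟨_, (AddCircle.equivIco G.period (-G.L) x).2, AddCircle.coe_equivIco⟩
  refine ⟨-r / G.u, fun t ht hn => ⟨?_, hp, ht⟩⟩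
  have h1 : 0 < G.u * t := mul_pos hu ht.1
  have h2 : G.u * t < G.u * G.T := mul_lt_mul_of_pos_left ht.2 hu
  simp only [charPoint]
  rw [← AddCircle.coe_add]
  rcases lt_or_ge t (-r / G.u) with h | h
  · have h3 := (lt_div_iff₀ hu).1 h
    exact mem_image_of_mem _ (Or.inl ⟨by linarith [hr.1], by linarith⟩)
  · have h4 : -r / G.u + G.d / G.u < t := by
      by_contra hc
      exact hn ⟨h, not_lt.1 hc⟩
    rw [← add_div] at h4
    have h3 := (div_lt_iff₀ hu).1 h4
    rcases le_or_gt (r + G.u * t) (G.d + G.L) with h5 | h5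
    · exact mem_image_of_mem _ (Or.inr ⟨by linarith, h5⟩)
    -- After wrapping around, the position lies in `(-L, uT - L)`, which is inside `(-L, 0)` because
    -- `L = 3uT`.
    · refine ⟨r + G.u * t - G.period, Or.inl ⟨by linarith, by linarith [hr.2]⟩, ?_⟩
      simp [AddCircle.coe_period]

theorem lintegral_Q_eq {h : G.Torus × ℝ × ℝ → ℝ≥0∞}
    (hh : AEMeasurable h (volume.restrict G.Q)) :
    ∫⁻ q in G.Q, h q = ∫⁻ p in G.Omega, ∫⁻ t in Ioo 0 G.T, h (charPoint G p t) := by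
  have hmp := measurePreserving_charPoint (G := G)
  rw [← hmp.map_eq, lintegral_map' (by rwa [hmp.map_eq]) hmp.measurable.aemeasurable,
    lintegral_prod (fun y : (G.Torus × ℝ) × ℝ => h (charPoint G y.1 y.2))
      (hh.comp_quasiMeasurePreserving hmp.quasiMeasurePreserving)]

end Observation

/-! ### The observability estimate for Duhamel's formula. -/

namespace WeightData

variable {G : Channel} (W : WeightData G)

/-- The observability estimate on almost every characteristic. -/
theorem exists_const_charPoint (c : ℝ) : ∃ C : ℝ≥0, 0 < C ∧
    ∀ (σT : G.Torus × ℝ → ℝ) (f : G.Torus × ℝ × ℝ → ℝ), IsData σT f →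
      ∀ s lam : ℝ, 1 ≤ s → 1 ≤ lam → ∀ p ∈ G.Omega,
        (Integrable fun τ => f (charPoint G p τ)) →
        ∫⁻ t in Ioo 0 G.T, ‖W.weight s lam (charPoint G p t)‖ₑ ^ 2 *
            ‖duhamel G c σT f (charPoint G p t)‖ₑ ^ 2 ≤
          C * ((∫⁻ t in Ioo 0 G.T, ‖W.weight s lam (charPoint G p t)‖ₑ ^ 2 *
              ‖f (charPoint G p t)‖ₑ ^ 2) +
            ∫⁻ t in Ioo 0 G.T, G.omegaT.indicator (fun q => ‖W.weight s lam q‖ₑ ^ 2 *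
              ‖duhamel G c σT f q‖ₑ ^ 2) (charPoint G p t)) := by
  set M := ENNReal.ofReal (Real.exp (|c| * G.T)) with hM
  set v := ENNReal.ofReal W.window with hv
  set τ := ENNReal.ofReal G.T with hτ
  have hv0 : v ≠ 0 := by simpa [hv] using W.window_pos
  have hvt : v ≠ ⊤ := ENNReal.ofReal_ne_top
  have hM2 : 2 * M ^ 2 ≠ ⊤ := ENNReal.mul_ne_top (by norm_num)
    (ENNReal.pow_ne_top ENNReal.ofReal_ne_top)
  -- The terms come from the observed times, the average over the window (divided by its length
  -- `v`), and the source.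
  set K : ℝ≥0∞ := 1 + 2 * M ^ 2 * τ * v⁻¹ + 2 * M ^ 2 * τ * τ with hK
  have hτt : τ ≠ ⊤ := ENNReal.ofReal_ne_top
  have hKt : K ≠ ⊤ := by
    refine ENNReal.add_ne_top.2 ⟨ENNReal.add_ne_top.2 ⟨ENNReal.one_ne_top, ?_⟩, ?_⟩
    · exact ENNReal.mul_ne_top (ENNReal.mul_ne_top hM2 hτt) (ENNReal.inv_ne_top.2 hv0)
    · exact ENNReal.mul_ne_top (ENNReal.mul_ne_top hM2 hτt) hτt
  have hK1 : 1 ≤ K := by rw [hK, add_assoc]; exact le_self_add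
  refine ⟨K.toNNReal, ENNReal.toNNReal_pos (zero_lt_one.trans_le hK1).ne' hKt, ?_⟩
  intro σT f hd s lam hs hl p hp hF
  rw [ENNReal.coe_toNNReal hKt]
  obtain ⟨a, ha⟩ := exists_charPoint_mem_omegaT p hp
  set w : ℝ → ℝ≥0∞ := fun t => ‖W.weight s lam (charPoint G p t)‖ₑ with hw
  set ρ : ℝ → ℝ := fun t => duhamel G c σT f (charPoint G p t) with hρ
  set Z := ∫⁻ t in Ioo 0 G.T, w t ^ 2 * ‖f (charPoint G p t)‖ₑ ^ 2 with hZ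
  set Y := ∫⁻ t in Ioo 0 G.T, G.omegaT.indicator (fun q => ‖W.weight s lam q‖ₑ ^ 2 *
    ‖duhamel G c σT f q‖ₑ ^ 2) (charPoint G p t) with hY
  have hgood : ∀ S ⊆ Ioo 0 G.T, MeasurableSet S → (∀ t ∈ S, t ∉ Icc a (a + G.d / G.u)) →
      ∫⁻ t in S, w t ^ 2 * ‖ρ t‖ₑ ^ 2 ≤ Y := by
    intro S hS hSm hSa
    refine le_trans ?_ (lintegral_mono_set hS)
    refine setLIntegral_mono' hSm fun t ht => ?_
    rw [indicator_of_mem (ha t (hS ht) (hSa t ht))]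
  have hsplit : ∫⁻ t in Ioo 0 G.T, w t ^ 2 * ‖ρ t‖ₑ ^ 2 =
      (∫⁻ t in Ioo 0 G.T ∩ Icc a (a + G.d / G.u), w t ^ 2 * ‖ρ t‖ₑ ^ 2) +
        ∫⁻ t in Ioo 0 G.T \ Icc a (a + G.d / G.u), w t ^ 2 * ‖ρ t‖ₑ ^ 2 :=
    (lintegral_inter_add_sdiff _ _ measurableSet_Icc).symm
  have h2 := hgood _ sdiff_subset (measurableSet_Ioo.diff measurableSet_Icc) fun t ht => ht.2
  rw [hsplit]
  rcases W.exists_window a with hno | ⟨j, hj, hja, hjθ⟩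
  · have : Ioo 0 G.T ∩ Icc a (a + G.d / G.u) = ∅ :=
      eq_empty_iff_forall_notMem.2 fun t ht => hno t ht.1 ht.2
    rw [this, Measure.restrict_empty, lintegral_zero_measure, zero_add]
    calc _ ≤ Y := h2
      _ ≤ Z + Y := le_add_self
      _ ≤ K * (Z + Y) := le_mul_of_one_le_left' hK1
  · have h1 := lintegral_le_of_window (ρ := ρ) (F := fun t => f (charPoint G p t)) (w := w)
      (M := M) (T := G.T) (B := Ioo 0 G.T ∩ Icc a (a + G.d / G.u)) (J := Ioo j (j + W.window))
      (hd.measurable_source.comp (measurable_charPoint.comp measurable_prodMk_left))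
      ENNReal.ofReal_ne_top (measurableSet_Ioo.inter measurableSet_Icc) measurableSet_Ioo
      inter_subset_left hj
      (fun t ht t' ht' τ hτ => W.weight_charPoint_le hs hl p
        (W.θ_pos (ordConnected_Ioo.uIcc_subset ht.1 (hj ht') hτ))
        (hjθ t ⟨ht.2, ht.1⟩ t' ht' τ hτ))
      (fun t ht t' ht' => enorm_duhamel_charPoint_le hd.source_eq_zero hF ht ht')
    rw [Real.volume_Ioo, add_sub_cancel_left] at h1
    have h3 := hgood _ hj measurableSet_Ioo hja
    set X := ∫⁻ t in Ioo 0 G.T ∩ Icc a (a + G.d / G.u), w t ^ 2 * ‖ρ t‖ₑ ^ 2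
    have h4 : X ≤ 2 * M ^ 2 * τ * v⁻¹ * Y + 2 * M ^ 2 * τ * τ * Z := by
      calc X = v⁻¹ * (v * X) := by
            rw [← mul_assoc, ENNReal.inv_mul_cancel hv0 hvt, one_mul]
        _ ≤ v⁻¹ * (2 * M ^ 2 * (Y + v * (τ * Z)) * τ) := by
            refine mul_le_mul_right (h1.trans ?_) _
            gcongr
        _ = 2 * M ^ 2 * τ * v⁻¹ * Y + (v⁻¹ * v) * (2 * M ^ 2 * τ * τ * Z) := by ring
        _ = _ := by rw [ENNReal.inv_mul_cancel hv0 hvt, one_mul]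
    calc _ ≤ (2 * M ^ 2 * τ * v⁻¹ * Y + 2 * M ^ 2 * τ * τ * Z) + Y := add_le_add h4 h2
      _ ≤ (2 * M ^ 2 * τ * v⁻¹ * Y + 2 * M ^ 2 * τ * τ * Z) + Y +
          (2 * M ^ 2 * τ * v⁻¹ * Z + 2 * M ^ 2 * τ * τ * Y + Z) := le_self_add
      _ = K * (Z + Y) := by rw [hK]; ring

/-- The square of the weighted norm as an integral. -/
theorem wnorm_sq (s lam : ℝ) (S : Set (G.Torus × ℝ × ℝ)) {F : Type*} [NormedAddCommGroup F]
    [NormedSpace ℝ F] (g : G.Torus × ℝ × ℝ → F) :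
    W.wnorm s lam S g ^ 2 = ∫⁻ q in S, ‖W.weight s lam q‖ₑ ^ 2 * ‖g q‖ₑ ^ 2 := by
  have := eLpNorm_nnreal_pow_eq_lintegral (p := 2) (μ := volume.restrict S)
    (f := fun q => W.weight s lam q • g q) (by norm_num)
  simp only [enorm_smul, NNReal.coe_ofNat, ENNReal.rpow_ofNat, ENNReal.coe_ofNat, mul_pow] at this
  exact this

theorem wnorm_congr (s lam : ℝ) {S : Set (G.Torus × ℝ × ℝ)} {F : Type*} [NormedAddCommGroup F]
    [NormedSpace ℝ F] {g g' : G.Torus × ℝ × ℝ → F} (hS : S ⊆ G.Q)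
    (h : g =ᵐ[volume.restrict G.Q] g') : W.wnorm s lam S g = W.wnorm s lam S g' :=
  eLpNorm_congr_ae ((ae_restrict_of_ae_restrict_of_subset hS h).mono fun q hq => by
    simp only [hq])

/-- The observability estimate for Duhamel's formula. -/
theorem exists_const_duhamel (c : ℝ) : ∃ C : ℝ≥0, 0 < C ∧
    ∀ (σT : G.Torus × ℝ → ℝ) (f : G.Torus × ℝ × ℝ → ℝ), IsData σT f →
      ∀ s lam : ℝ, 1 ≤ s → 1 ≤ lam →
        W.wnorm s lam G.Q (duhamel G c σT f) ^ 2 ≤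
          C * (W.wnorm s lam G.Q f ^ 2 + W.wnorm s lam G.omegaT (duhamel G c σT f) ^ 2) := by
  obtain ⟨C, hC, h⟩ := W.exists_const_charPoint c
  refine ⟨C, hC, fun σT f hd s lam hs hl => ?_⟩
  have hw := W.aemeasurable_weight s lam
  set H : G.Torus × ℝ × ℝ → ℝ≥0∞ :=
    fun q => ‖W.weight s lam q‖ₑ ^ 2 * ‖duhamel G c σT f q‖ₑ ^ 2 with hH
  set Hf : G.Torus × ℝ × ℝ → ℝ≥0∞ := fun q => ‖W.weight s lam q‖ₑ ^ 2 * ‖f q‖ₑ ^ 2 with hHf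
  have hHm : AEMeasurable H (volume.restrict G.Q) :=
    (hw.enorm.pow_const 2).mul
      ((measurable_duhamel hd.measurable_final hd.measurable_source).enorm.pow_const 2).aemeasurable
  have hHfm : AEMeasurable Hf (volume.restrict G.Q) :=
    (hw.enorm.pow_const 2).mul (hd.measurable_source.enorm.pow_const 2).aemeasurable
  have hHi : AEMeasurable (G.omegaT.indicator H) (volume.restrict G.Q) :=
    hHm.indicator G.measurableSet_omegaT
  have hω : ∫⁻ q in G.omegaT, H q = ∫⁻ q in G.Q, G.omegaT.indicator H q := by
    rw [lintegral_indicator G.measurableSet_omegaT,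
      Measure.restrict_restrict_of_subset G.omegaT_subset_Q]
  rw [wnorm_sq, wnorm_sq, wnorm_sq]
  calc ∫⁻ q in G.Q, H q
      = ∫⁻ p in G.Omega, ∫⁻ t in Ioo 0 G.T, H (charPoint G p t) := lintegral_Q_eq hHm
    _ ≤ ∫⁻ p in G.Omega, C * ∫⁻ t in Ioo 0 G.T,
          (Hf (charPoint G p t) + G.omegaT.indicator H (charPoint G p t)) := by
        refine lintegral_mono_ae ?_
        filter_upwards [hd.ae_integrable_charPoint, ae_restrict_mem G.measurableSet_Omega]
          with p hp hpΩ
        -- Superadditivity of the lower integral avoids checking measurability on each single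
        -- characteristic.
        exact (h σT f hd s lam hs hl p hpΩ hp).trans
          (mul_le_mul_right (le_lintegral_add _ _) _)
    _ = C * ∫⁻ q in G.Q, (Hf q + G.omegaT.indicator H q) := by
        rw [lintegral_const_mul' _ _ ENNReal.coe_ne_top, ← lintegral_Q_eq (h := fun q => Hf q + G.omegaT.indicator H q)
          (hHfm.add hHi)]
    _ = C * ((∫⁻ q in G.Q, Hf q) + ∫⁻ q in G.omegaT, H q) := by
        rw [lintegral_add_left' hHfm, hω]

end WeightData

/-! ### Weak solutions and their gradients. -/

namespace WeightData

variable {G : Channel} (W : WeightData G)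

theorem wnorm_add_le (s lam : ℝ) {S : Set (G.Torus × ℝ × ℝ)} (hS : S ⊆ G.Q)
    {g h : G.Torus × ℝ × ℝ → ℝ} (hg : AEStronglyMeasurable g (volume.restrict G.Q))
    (hh : AEStronglyMeasurable h (volume.restrict G.Q)) :
    W.wnorm s lam S (g + h) ≤ W.wnorm s lam S g + W.wnorm s lam S h := by
  have hw := (W.aemeasurable_weight s lam).aestronglyMeasurable
  have := eLpNorm_add_le (p := 2) ((hw.smul hg).mono_measure (Measure.restrict_mono_set _ hS))
    ((hw.smul hh).mono_measure (Measure.restrict_mono_set _ hS)) (by norm_num)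
  rw [← smul_add] at this
  exact this

theorem wnorm_const_mul (s lam : ℝ) (S : Set (G.Torus × ℝ × ℝ)) (a : ℝ)
    (g : G.Torus × ℝ × ℝ → ℝ) :
    W.wnorm s lam S (fun q => a * g q) = ‖a‖ₑ * W.wnorm s lam S g := by
  rw [wnorm, wnorm, ← eLpNorm_const_smul]
  congr 1
  funext q
  simp only [Pi.smul_apply, smul_eq_mul]
  ring

/-- Squared norms add over components, so two scalar estimates with the same constant give the
gradient estimate. -/
theorem wnorm_euclidean_sq (s lam : ℝ) {S : Set (G.Torus × ℝ × ℝ)} (hS : S ⊆ G.Q)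
    {g : G.Torus × ℝ × ℝ → EuclideanSpace ℝ (Fin 2)}
    (hg : AEStronglyMeasurable (fun q => g q 0) (volume.restrict G.Q)) :
    W.wnorm s lam S g ^ 2 =
      W.wnorm s lam S (fun q => g q 0) ^ 2 + W.wnorm s lam S (fun q => g q 1) ^ 2 := by
  have hm : AEMeasurable (fun q => ‖W.weight s lam q‖ₑ ^ 2 * ‖g q 0‖ₑ ^ 2) (volume.restrict S) :=
    (((W.aemeasurable_weight s lam).enorm.pow_const 2).mul
      (hg.enorm.pow_const 2)).mono_measure (Measure.restrict_mono_set _ hS)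
  rw [wnorm_sq, wnorm_sq, wnorm_sq, ← lintegral_add_left' hm]
  congr 1
  funext q
  rw [← mul_add]
  congr 1
  have h := EuclideanSpace.norm_sq_eq (g q)
  rw [Fin.sum_univ_two] at h
  simp only [← ofReal_norm]
  rw [← ENNReal.ofReal_pow (norm_nonneg _), ← ENNReal.ofReal_pow (norm_nonneg _),
    ← ENNReal.ofReal_pow (norm_nonneg _), ← ENNReal.ofReal_add (by positivity) (by positivity), h]

/-- The observability estimate for weak solutions. -/
theorem exists_const_solution (c : ℝ) : ∃ C : ℝ≥0, 0 < C ∧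
    ∀ (σT : G.Torus × ℝ → ℝ) (f σ : G.Torus × ℝ × ℝ → ℝ),
      MemLp σT 2 (volume.restrict G.Omega) → MemLp f 2 (volume.restrict G.Q) →
      IsSolution G c f σT σ → ∀ s lam : ℝ, 1 ≤ s → 1 ≤ lam →
        W.wnorm s lam G.Q σ ^ 2 ≤
          C * (W.wnorm s lam G.Q f ^ 2 + W.wnorm s lam G.omegaT σ ^ 2) := by
  obtain ⟨C, hC, h⟩ := W.exists_const_duhamel c
  refine ⟨C, hC, fun σT f σ hσT hf hσ s lam hs hl => ?_⟩
  obtain ⟨σT', f', hd, hσT', hf'⟩ := exists_isData hσT hf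
  have he := (hσ.congr_data hσT' hf').ae_eq_duhamel hd
  rw [W.wnorm_congr s lam Subset.rfl he, W.wnorm_congr s lam G.omegaT_subset_Q he,
    W.wnorm_congr s lam Subset.rfl hf']
  exact h σT' f' hd s lam hs hl

/-- The gradient of a weak solution and its observability estimate. -/
theorem exists_const_gradient (c : ℝ) : ∃ C : ℝ≥0, 0 < C ∧
    ∀ (σT : G.Torus × ℝ → ℝ) (f σ : G.Torus × ℝ × ℝ → ℝ)
      (gradf : G.Torus × ℝ × ℝ → EuclideanSpace ℝ (Fin 2)),
      MemH1 G σT → HasL2Gradient G f gradf → IsSolution G c f σT σ →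
      ∃ gradσ : G.Torus × ℝ × ℝ → EuclideanSpace ℝ (Fin 2),
        HasL2Gradient G σ gradσ ∧
        ∀ s lam : ℝ, 1 ≤ s → 1 ≤ lam →
          W.wnorm s lam G.Q gradσ ^ 2 ≤
            C * (W.wnorm s lam G.Q gradf ^ 2 + W.wnorm s lam G.omegaT gradσ ^ 2) := by
  obtain ⟨C, hC, h⟩ := W.exists_const_duhamel c
  refine ⟨C, hC, fun σT f σ gradf hσT hf hσ => ?_⟩
  obtain ⟨-, gx, gz, hgx, hgz, hdx, hdz⟩ := hσT
  have hfx : MemLp (fun q => gradf q 0) 2 (volume.restrict G.Q) :=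
    hf.memLp_grad.continuousLinearMap_comp (EuclideanSpace.proj (𝕜 := ℝ) (0 : Fin 2))
  have hfz : MemLp (fun q => gradf q 1) 2 (volume.restrict G.Q) :=
    hf.memLp_grad.continuousLinearMap_comp (EuclideanSpace.proj (𝕜 := ℝ) (1 : Fin 2))
  obtain ⟨gx', fx', hd0, hgx', hfx'⟩ := exists_isData hgx hfx
  obtain ⟨gz', fz', hd1, hgz', hfz'⟩ := exists_isData hgz hfz
  have m0 := hd0.memLp_duhamel (c := c)
  have m1 := hd1.memLp_duhamel (c := c)
  refine ⟨fun q => !₂[duhamel G c gx' fx' q, duhamel G c gz' fz' q], ⟨hσ.memLp, ?_, ?_, ?_⟩, ?_⟩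
  · refine MemLp.of_eval_piLp fun i => ?_
    fin_cases i
    · exact m0
    · exact m1
  · exact hσ.hasWeakDeriv (v := (1, 0)) hf.memLp hfx hdx hf.deriv_x hd0 hgx' hfx'
  · exact hσ.hasWeakDeriv (v := (0, 1)) hf.memLp hfz hdz hf.deriv_z hd1 hgz' hfz'
  · intro s lam hs hl
    rw [W.wnorm_euclidean_sq s lam Subset.rfl m0.1, W.wnorm_euclidean_sq s lam Subset.rfl hfx.1,
      W.wnorm_euclidean_sq s lam G.omegaT_subset_Q m0.1,
      W.wnorm_congr s lam Subset.rfl hfx', W.wnorm_congr s lam Subset.rfl hfz']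
    refine (add_le_add (h _ _ hd0 s lam hs hl) (h _ _ hd1 s lam hs hl)).trans_eq ?_
    simp only [Matrix.cons_val_zero, Matrix.cons_val_one]
    ring

end WeightData

/-! ### The time derivative through the equation. -/

section TimeDerivative

variable {G : Channel} {c : ℝ} {σT : G.Torus × ℝ → ℝ} {f σ : G.Torus × ℝ × ℝ → ℝ}

/-- The weak time derivative of a solution, expressed through the equation. -/
theorem IsSolution.hasL2TimeDeriv {g : G.Torus × ℝ × ℝ → ℝ} (h : IsSolution G c f σT σ)
    (hf : MemLp f 2 (volume.restrict G.Q)) (hg : MemLp g 2 (volume.restrict G.Q))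
    (hx : HasWeakDeriv G G.Q (1, (0, 0)) σ g) :
    HasL2TimeDeriv G σ ((fun q => c * σ q) + ((fun q => -1 * f q) + fun q => -G.u * g q)) := by
  refine ⟨(h.memLp.const_mul c).add ((hf.const_mul (-1)).add (hg.const_mul (-G.u))), ?_⟩
  intro χ hχ
  have hw := h.weak χ (hχ.mono G.Q_subset_Qpos)
  -- A test function supported in `Q` vanishes at `t = T`, so the final value drops out of the weak
  -- formulation.
  have h0 : ∀ p : G.Torus × ℝ, χ (p.1, p.2, G.T) = 0 := fun p => by
    by_contra hn
    exact lt_irrefl _ (hχ.support_subset (subset_tsupport _ hn)).2.2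
  simp only [h0, mul_zero, integral_zero, add_zero] at hw
  have hσi := integrable_of_memLp_two h.memLp
  have i1 := (hχ.dirDeriv (0, (0, 1))).integrable_mul hσi
  have i2 := ((hχ.dirDeriv (1, (0, 0))).integrable_mul hσi).const_mul G.u
  have i3 := (hχ.integrable_mul hσi).const_mul c
  have i4 := (hχ.integrable_mul (integrable_of_memLp_two hf)).const_mul (-1)
  have i5 := (hχ.integrable_mul (integrable_of_memLp_two hg)).const_mul (-G.u)
  have e1 : ∀ q, σ q * (dirDeriv G (0, (0, 1)) χ q + G.u * dirDeriv G (1, (0, 0)) χ q +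
      c * χ q) = σ q * dirDeriv G (0, (0, 1)) χ q +
        G.u * (σ q * dirDeriv G (1, (0, 0)) χ q) + c * (σ q * χ q) := fun q => by ring
  have e2 : ∀ q, ((fun q => c * σ q) + ((fun q => -1 * f q) + fun q => -G.u * g q)) q * χ q =
      c * (σ q * χ q) + (-1 * (f q * χ q) + -G.u * (g q * χ q)) := fun q => by
    simp only [Pi.add_apply]
    ring
  simp only [e1] at hw
  simp only [e2]
  rw [integral_add (f := fun q => σ q * dirDeriv G (0, (0, 1)) χ q +
    G.u * (σ q * dirDeriv G (1, (0, 0)) χ q)) (i1.add i2) i3, integral_add i1 i2, integral_const_mul, integral_const_mul,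
    hx χ hχ] at hw
  rw [integral_add (g := fun q => -1 * (f q * χ q) + -G.u * (g q * χ q)) i3 (i4.add i5), integral_add i4 i5, integral_const_mul, integral_const_mul,
    integral_const_mul]
  linarith

end TimeDerivative

/-- The observability estimate for the time derivative. -/
theorem WeightData.wnorm_timeDeriv_sq_le {G : Channel} (W : WeightData G) (s lam c : ℝ)
    {σ f g : G.Torus × ℝ × ℝ → ℝ} (hσ : AEStronglyMeasurable σ (volume.restrict G.Q))
    (hf : AEStronglyMeasurable f (volume.restrict G.Q))
    (hg : AEStronglyMeasurable g (volume.restrict G.Q)) :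
    W.wnorm s lam G.Q ((fun q => c * σ q) + ((fun q => -1 * f q) + fun q => -G.u * g q)) ^ 2 ≤
      2 * ‖c‖ₑ ^ 2 * W.wnorm s lam G.Q σ ^ 2 + 4 * W.wnorm s lam G.Q f ^ 2 +
        4 * ‖G.u‖ₑ ^ 2 * W.wnorm s lam G.Q g ^ 2 := by
  have hc := hσ.const_mul c
  have hf' := hf.const_mul (-1)
  have hg' := hg.const_mul (-G.u)
  have h1 := (W.wnorm_add_le s lam Subset.rfl hc (hf'.add hg')).trans
    (add_le_add_right (W.wnorm_add_le s lam Subset.rfl hf' hg') _)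
  rw [W.wnorm_const_mul, W.wnorm_const_mul, W.wnorm_const_mul, enorm_neg, enorm_neg, enorm_one,
    one_mul] at h1
  refine (pow_le_pow_left' h1 2).trans ((sq_add_le_two_mul _ _).trans ?_)
  calc _ ≤ 2 * ((‖c‖ₑ * W.wnorm s lam G.Q σ) ^ 2 + 2 * (W.wnorm s lam G.Q f ^ 2 +
        (‖G.u‖ₑ * W.wnorm s lam G.Q g) ^ 2)) := by
        gcongr
        exact sq_add_le_two_mul _ _
    _ = _ := by ring

end TransportObs

end

/-! ### Assembly of the three estimates. -/

theorem mainTheorem7 (G : TransportObs.Channel) (W : TransportObs.WeightData G) (c : ℝ) :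
    (∃ C : ℝ≥0, 0 < C ∧
      ∀ (σT : G.Torus × ℝ → ℝ) (f σ : G.Torus × ℝ × ℝ → ℝ),
        MemLp σT 2 (volume.restrict G.Omega) →
        MemLp f 2 (volume.restrict G.Q) →
        TransportObs.IsSolution G c f σT σ →
        ∀ s lam : ℝ, 1 ≤ s → 1 ≤ lam →
          W.wnorm s lam G.Q σ ^ 2 ≤
            C * (W.wnorm s lam G.Q f ^ 2 + W.wnorm s lam G.omegaT σ ^ 2)) ∧
    (∃ C : ℝ≥0, 0 < C ∧
      ∀ (σT : G.Torus × ℝ → ℝ) (f σ : G.Torus × ℝ × ℝ → ℝ)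
        (gradf : G.Torus × ℝ × ℝ → EuclideanSpace ℝ (Fin 2)),
        TransportObs.MemH1 G σT →
        TransportObs.HasL2Gradient G f gradf →
        TransportObs.IsSolution G c f σT σ →
        ∃ gradσ : G.Torus × ℝ × ℝ → EuclideanSpace ℝ (Fin 2),
          TransportObs.HasL2Gradient G σ gradσ ∧
          ∀ s lam : ℝ, 1 ≤ s → 1 ≤ lam →
            W.wnorm s lam G.Q gradσ ^ 2 ≤
              C * (W.wnorm s lam G.Q gradf ^ 2 + W.wnorm s lam G.omegaT gradσ ^ 2)) ∧
    (∃ C : ℝ≥0, 0 < C ∧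
      ∀ (σT : G.Torus × ℝ → ℝ) (f σ : G.Torus × ℝ × ℝ → ℝ)
        (gradf : G.Torus × ℝ × ℝ → EuclideanSpace ℝ (Fin 2)),
        TransportObs.MemH1 G σT →
        TransportObs.HasL2Gradient G f gradf →
        TransportObs.IsSolution G c f σT σ →
        ∃ (gradσ : G.Torus × ℝ × ℝ → EuclideanSpace ℝ (Fin 2))
          (dtσ : G.Torus × ℝ × ℝ → ℝ),
          TransportObs.HasL2Gradient G σ gradσ ∧
          TransportObs.HasL2TimeDeriv G σ dtσ ∧
          ∀ s lam : ℝ, 1 ≤ s → 1 ≤ lam →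
            W.wnorm s lam G.Q dtσ ^ 2 ≤
              C * (W.wnorm s lam G.Q gradf ^ 2 + W.wnorm s lam G.Q f ^ 2 +
                W.wnorm s lam G.omegaT σ ^ 2 + W.wnorm s lam G.omegaT gradσ ^ 2)) := by
  refine ⟨W.exists_const_solution c, W.exists_const_gradient c, ?_⟩
  obtain ⟨C₁, -, h₁⟩ := W.exists_const_solution c
  obtain ⟨C₂, -, h₂⟩ := W.exists_const_gradient c
  -- The coefficients `2|c|²`, `4`, `4u²` are those of `wnorm_timeDeriv_sq_le`; `C₁` and `C₂` then
  -- bound `σ` and `∂ₓσ`.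
  refine ⟨2 * ‖c‖₊ ^ 2 * C₁ + 4 + 4 * ‖G.u‖₊ ^ 2 * C₂, by positivity, ?_⟩
  intro σT f σ gradf hσT hf hσ
  obtain ⟨gradσ, hgrad, hest⟩ := h₂ σT f σ gradf hσT hf hσ
  have hx : MemLp (fun q => gradσ q 0) 2 (volume.restrict G.Q) :=
    hgrad.memLp_grad.continuousLinearMap_comp (EuclideanSpace.proj (𝕜 := ℝ) (0 : Fin 2))
  refine ⟨gradσ, _, hgrad, hσ.hasL2TimeDeriv hf.memLp hx hgrad.deriv_x, ?_⟩
  intro s lam hs hl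
  have e₁ := h₁ σT f σ hσT.1 hf.memLp hσ s lam hs hl
  have e₂ : W.wnorm s lam G.Q (fun q => gradσ q 0) ^ 2 ≤
      C₂ * (W.wnorm s lam G.Q gradf ^ 2 + W.wnorm s lam G.omegaT gradσ ^ 2) := by
    refine le_trans ?_ (hest s lam hs hl)
    rw [W.wnorm_euclidean_sq s lam Subset.rfl hx.1]
    exact le_self_add
  refine (W.wnorm_timeDeriv_sq_le s lam c hσ.memLp.1 hf.memLp.1 hx.1).trans ?_
  set a := W.wnorm s lam G.Q gradf ^ 2
  set b := W.wnorm s lam G.Q f ^ 2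
  set d := W.wnorm s lam G.omegaT σ ^ 2
  set e := W.wnorm s lam G.omegaT gradσ ^ 2
  push_cast
  rw [← enorm_eq_nnnorm c, ← enorm_eq_nnnorm G.u]
  calc _ ≤ 2 * ‖c‖ₑ ^ 2 * (C₁ * (a + b + d + e)) + 4 * (a + b + d + e) +
        4 * ‖G.u‖ₑ ^ 2 * (C₂ * (a + b + d + e)) := by
        gcongr
        · refine e₁.trans (mul_le_mul_right ?_ _)
          calc b + d ≤ b + d + (a + e) := le_self_add
            _ = _ := by ring
        · calc b ≤ b + (a + d + e) := le_self_add
            _ = _ := by ring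
        · refine e₂.trans (mul_le_mul_right ?_ _)
          calc a + e ≤ a + e + (b + d) := le_self_add
            _ = _ := by ring
    _ = _ := by ring
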